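/- Let $x(s)$, $s\in\mathbb{C}$, be either a $q$-quadratic lattice $x(s)=c_1q^{-s}+c_2q^{s}+c_3$, where $c_1,c_2,c_3,q\in\mathbb{C}$, $c_1\neq 0$, $q\neq 0$ and $q^n\neq 1$ for all $n\geq 1$ (principal branch of $q^s$), or a quadratic lattice $x(s)=c_4s^2+c_5s+c_6$, where $c_4,c_5,c_6\in\mathbb{C}$, $c_4\neq 0$. For a polynomial $f\in\mathbb{C}[x]$ let $\mathbb{D}_xf$ and $\mathbb{S}_xf$ be the polynomials determined by $$\mathbb{D}_xf(x(s))=\frac{f(x(s+\frac12))-f(x(s-\frac12))}{x(s+\frac12)-x(s-\frac12)},\qquad \mathbb{S}_xf(x(s))=\frac{f(x(s+\frac12))+f(x(s-\frac12))}{2}.$$ Let $\mu$ be a positive measure on $\mathbb{R}$ with finite moments (for instance $d\mu=w(x)\,dx$ with a weight function $w\ge 0$), and let $\{P_n\}_{n\ge0}$ be real polynomials with $\deg P_n=n$, $\int P_mP_n\,d\mu=0$ for $m\neq n$ and $\int P_n^2\,d\mu>0$. The following three conditions are equivalent: (a) There are a polynomial $\pi\in\mathbb{C}[x]$ of degree at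 most $4$ and numbers $a_{n,n+k}\in\mathbb{C}$ ($n\ge2$, $-2\le k\le2$) such that, for all $n\geq 2$, $a_{n,n-2}\neq0$ and $$\pi\,\mathbb{D}_x^2P_n=\sum_{k=-2}^{2}a_{n,n+k}P_{n+k}.$$ (b) There is a polynomial $\pi\in\mathbb{C}[x]$ of degree at most $4$ such that $\{\mathbb{D}_x^2P_n\}_{n\ge2}$ is orthogonal with respect to $\pi\,d\mu$, that is, for $m,n\ge2$, $\int \mathbb{D}_x^2P_m\,\mathbb{D}_x^2P_n\,\pi\,d\mu$ is zero if $m\neq n$ and nonzero if $m=n$. (c) There are polynomials $\phi,\psi\in\mathbb{C}[x]$ with $\deg\phi\le2$ and $\deg\psi=1$, and constants $\lambda_n\in\mathbb{C}$, such that for all $n\ge5$ $$\phi\,\mathbb{D}_x^2P_n+\psi\,\mathbb{S}_x\mathbb{D}_xP_n+\lambda_nP_n=0.$$ -/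

import Mathlib

open Polynomial MeasureTheory

/-- The quadratic and `q`-quadratic lattices.  The parameters are complex; `q` is nonzero, different
from `1` and not a root of unity. -/
inductive QLattice : Type
  | qQuadratic (q c₁ c₂ c₃ : ℂ) (q_ne_zero : q ≠ 0) (q_pow_ne_one : ∀ n : ℕ, 1 ≤ n → q ^ n ≠ 1)
      (c₁_ne_zero : c₁ ≠ 0) : QLattice
  | quadratic (c₄ c₅ c₆ : ℂ) (c₄_ne_zero : c₄ ≠ 0) : QLattice

namespace QLattice

/-- The lattice function `s ↦ x(s)`, `s ∈ ℂ`. -/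
noncomputable def x : QLattice → ℂ → ℂ
  | qQuadratic q c₁ c₂ c₃ _ _ _ => fun s => c₁ * q ^ (-s) + c₂ * q ^ s + c₃
  | quadratic c₄ c₅ c₆ _ => fun s => c₄ * s ^ 2 + c₅ * s + c₆

/-- The mean of two neighbouring lattice points is an affine function of the midpoint. -/
theorem exists_mean (L : QLattice) :
    ∃ α β : ℂ, ∀ s, (L.x (s + 1 / 2) + L.x (s - 1 / 2)) / 2 = α * L.x s + β := by
  cases L with
  | qQuadratic q c₁ c₂ c₃ hq hr hc =>
    refine ⟨(q ^ (1 / 2 : ℂ) + q ^ (-(1 / 2) : ℂ)) / 2,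
      c₃ - (q ^ (1 / 2 : ℂ) + q ^ (-(1 / 2) : ℂ)) / 2 * c₃, fun s => ?_⟩
    have e1 : -(s + 1 / 2) = -s + -(1 / 2) := by ring
    have e2 : -(s - 1 / 2) = -s + 1 / 2 := by ring
    have e3 : s - 1 / 2 = s + -(1 / 2) := by ring
    simp only [x]
    rw [e1, e2, e3]
    simp only [Complex.cpow_add _ _ hq]
    ring
  | quadratic c₄ c₅ c₆ hc =>
    refine ⟨1, c₄ / 4, fun s => ?_⟩
    simp only [x]
    ring

/-- The square of half the difference of two neighbouring lattice points is a polynomial in the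
midpoint. -/
theorem exists_sq_diff (L : QLattice) :
    ∃ U : ℂ[X], ∀ s, U.eval (L.x s) = ((L.x (s + 1 / 2) - L.x (s - 1 / 2)) / 2) ^ 2 := by
  cases L with
  | qQuadratic q c₁ c₂ c₃ hq hr hc =>
    refine ⟨C (((q ^ (1 / 2 : ℂ) - q ^ (-(1 / 2) : ℂ)) / 2) ^ 2) *
      ((X - C c₃) ^ 2 - C (4 * c₁ * c₂)), fun s => ?_⟩
    have e1 : -(s + 1 / 2) = -s + -(1 / 2) := by ring
    have e2 : -(s - 1 / 2) = -s + 1 / 2 := by ring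
    have e3 : s - 1 / 2 = s + -(1 / 2) := by ring
    have h : q ^ (-s) * q ^ s = 1 := by
      rw [← Complex.cpow_add _ _ hq]; simp
    simp only [x, eval_mul, eval_C, eval_sub, eval_pow, eval_X]
    rw [e1, e2, e3]
    simp only [Complex.cpow_add _ _ hq]
    linear_combination (((q ^ (1 / 2 : ℂ) - q ^ (-(1 / 2) : ℂ)) / 2) ^ 2) * (4 * c₁ * c₂) * h
  | quadratic c₄ c₅ c₆ hc =>
    refine ⟨C c₄ * X + C (c₅ ^ 2 / 4 - c₄ * c₆), fun s => ?_⟩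
    simp only [x, eval_add, eval_mul, eval_C, eval_X]
    ring

/-- The divided difference and the mean of a polynomial in `x(s)` are polynomials in `x(s)`. -/
theorem exists_ops (L : QLattice) (f : ℂ[X]) :
    ∃ d m : ℂ[X], ∀ s,
      d.eval (L.x s) * (L.x (s + 1 / 2) - L.x (s - 1 / 2)) =
        f.eval (L.x (s + 1 / 2)) - f.eval (L.x (s - 1 / 2)) ∧
      m.eval (L.x s) = (f.eval (L.x (s + 1 / 2)) + f.eval (L.x (s - 1 / 2))) / 2 := by
  obtain ⟨α, β, hαβ⟩ := L.exists_mean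
  obtain ⟨U, hU⟩ := L.exists_sq_diff
  induction f using Polynomial.induction_on with
  | C a => exact ⟨0, C a, fun s => by simp⟩
  | add f g hf hg =>
    obtain ⟨d, m, h⟩ := hf
    obtain ⟨d', m', h'⟩ := hg
    refine ⟨d + d', m + m', fun s => ?_⟩
    obtain ⟨h1, h2⟩ := h s
    obtain ⟨h3, h4⟩ := h' s
    simp only [eval_add]
    exact ⟨by linear_combination h1 + h3, by linear_combination h2 + h4⟩
  | monomial n a hf =>
    obtain ⟨d, m, h⟩ := hf
    refine ⟨d * (C α * X + C β) + m, m * (C α * X + C β) + d * U, fun s => ?_⟩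
    obtain ⟨h1, h2⟩ := h s
    have h3 := hαβ s
    have h4 := hU s
    simp only [eval_add, eval_mul, eval_C, eval_X, eval_pow] at *
    rw [← h3, h4, pow_succ, pow_succ, h2]
    exact ⟨by linear_combination ((L.x (s + 1 / 2) + L.x (s - 1 / 2)) / 2) * h1,
      by linear_combination ((L.x (s + 1 / 2) - L.x (s - 1 / 2)) / 4) * h1⟩

/-- A polynomial is determined by its values at the lattice points `x(s)` with
`x(s + 1/2) ≠ x(s - 1/2)`. -/
theorem poly_ext (L : QLattice) {f g : ℂ[X]}
    (h : ∀ s, L.x (s + 1 / 2) ≠ L.x (s - 1 / 2) → f.eval (L.x s) = g.eval (L.x s)) : f = g := by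
  classical
  by_contra hfg
  have hne : f - g ≠ 0 := sub_ne_zero.2 hfg
  have key : ∀ s, L.x (s + 1 / 2) = L.x (s - 1 / 2) ∨ L.x s ∈ (f - g).roots.toFinset := by
    intro s
    by_cases hs : L.x (s + 1 / 2) = L.x (s - 1 / 2)
    · exact Or.inl hs
    · right
      simp [hne, h s hs]
  generalize (f - g).roots.toFinset = R at key
  have main : ∀ (e : ℕ → ℂ) (W : ℂ[X]) (V : ℂ → ℂ[X]), Function.Injective e → W ≠ 0 →
      (∀ r, V r ≠ 0) → (∀ n, W.eval (e n) = 0 ∨ ∃ r ∈ R, (V r).eval (e n) = 0) → False := by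
    intro e W V he hW hV hn
    have h0 : W * ∏ r ∈ R, V r ≠ 0 := mul_ne_zero hW (Finset.prod_ne_zero_iff.2 fun r _ => hV r)
    refine h0 (eq_zero_of_infinite_isRoot _
      ((Set.infinite_range_of_injective he).mono ?_))
    rintro _ ⟨n, rfl⟩
    simp only [Set.mem_ofPred_eq, IsRoot.def, eval_mul, eval_prod]
    rcases hn n with h1 | ⟨r, hr, h1⟩
    · rw [h1, zero_mul]
    · rw [Finset.prod_eq_zero hr h1, mul_zero]
  cases L with
  | qQuadratic q c₁ c₂ c₃ hq hr hc =>
    refine main (fun n => q ^ n) (C c₂ * X ^ 2 - C c₁)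
      (fun r => C c₁ + C (c₃ - r) * X + C c₂ * X ^ 2) ?_ ?_ ?_ ?_
    · intro m n hmn
      by_contra hne'
      wlog hlt : m < n generalizing m n
      · exact this hmn.symm (Ne.symm hne') (by omega)
      · refine hr (n - m) (by omega) ?_
        have h1 : q ^ n = q ^ m * q ^ (n - m) := by rw [← pow_add]; congr 1; omega
        have h2 : q ^ m * q ^ (n - m) = q ^ m * 1 := by rw [← h1, mul_one]; exact hmn.symm
        exact mul_left_cancel₀ (pow_ne_zero _ hq) h2
    · intro h0
      have := congrArg (eval 0) h0
      simp [hc] at this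
    · intro r h0
      have := congrArg (eval 0) h0
      simp [hc] at this
    · intro n
      have e1 : -((n : ℂ) + 1 / 2) = -n + -(1 / 2) := by ring
      have e2 : -((n : ℂ) - 1 / 2) = -n + 1 / 2 := by ring
      have e3 : (n : ℂ) - 1 / 2 = n + -(1 / 2) := by ring
      have hz : q ^ n ≠ 0 := pow_ne_zero n hq
      have hk : q ^ (1 / 2 : ℂ) - q ^ (-(1 / 2) : ℂ) ≠ 0 := by
        intro hk
        have h1 : q ^ (1 / 2 : ℂ) * q ^ (1 / 2 : ℂ) = q := by
          rw [← Complex.cpow_add _ _ hq]; norm_num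
        have h2 : q ^ (1 / 2 : ℂ) * q ^ (-(1 / 2) : ℂ) = 1 := by
          rw [← Complex.cpow_add _ _ hq]; norm_num
        refine hr 1 le_rfl ?_
        linear_combination -h1 + h2 + q ^ (1 / 2 : ℂ) * hk
      rcases key n with h1 | h1
      · left
        simp only [x] at h1
        rw [e1, e2, e3] at h1
        simp only [Complex.cpow_add _ _ hq, Complex.cpow_neg _ (n : ℂ), Complex.cpow_natCast] at h1
        simp only [eval_sub, eval_mul, eval_C, eval_pow, eval_X]
        apply mul_left_cancel₀ hk
        field_simp at h1
        linear_combination h1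
      · right
        refine ⟨_, h1, ?_⟩
        simp only [x, Complex.cpow_neg _ (n : ℂ), Complex.cpow_natCast, eval_add, eval_mul, eval_C,
          eval_pow, eval_X]
        field_simp
        ring
  | quadratic c₄ c₅ c₆ hc =>
    refine main (fun n => n) (C (2 * c₄) * X + C c₅)
      (fun r => C c₄ * X ^ 2 + C c₅ * X + C (c₆ - r)) Nat.cast_injective ?_ ?_ ?_
    · intro h0
      have := congrArg (coeff · 1) h0
      simp [hc] at this
    · intro r h0
      have := congrArg (coeff · 2) h0
      simp [hc] at this
    · intro n
      rcases key n with h1 | h1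
      · left
        simp only [x] at h1
        simp only [eval_add, eval_mul, eval_C, eval_X]
        linear_combination h1
      · right
        refine ⟨_, h1, ?_⟩
        simp only [x, eval_add, eval_mul, eval_C, eval_pow, eval_X]
        ring

theorem existsUnique_divDiff (L : QLattice) (f : ℂ[X]) :
    ∃! d : ℂ[X], ∀ s, d.eval (L.x s) * (L.x (s + 1 / 2) - L.x (s - 1 / 2)) =
      f.eval (L.x (s + 1 / 2)) - f.eval (L.x (s - 1 / 2)) := by
  obtain ⟨d, m, h⟩ := L.exists_ops f
  refine ⟨d, fun s => (h s).1, fun d' hd' => L.poly_ext fun s hs => ?_⟩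
  exact mul_right_cancel₀ (sub_ne_zero.2 hs) ((hd' s).trans (h s).1.symm)

theorem existsUnique_mean (L : QLattice) (f : ℂ[X]) :
    ∃! m : ℂ[X], ∀ s, m.eval (L.x s) =
      (f.eval (L.x (s + 1 / 2)) + f.eval (L.x (s - 1 / 2))) / 2 := by
  obtain ⟨d, m, h⟩ := L.exists_ops f
  exact ⟨m, fun s => (h s).2,
    fun m' hm' => L.poly_ext fun s _ => (hm' s).trans (h s).2.symm⟩

/-- The divided-difference operator `𝔻ₓ` on polynomials: `𝔻ₓ f` is the polynomial with
`(𝔻ₓ f)(x(s)) = (f(x(s + 1/2)) - f(x(s - 1/2))) / (x(s + 1/2) - x(s - 1/2))`. -/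
noncomputable def D (L : QLattice) (f : ℂ[X]) : ℂ[X] := (L.existsUnique_divDiff f).choose

theorem D_spec (L : QLattice) (f : ℂ[X]) (s : ℂ) :
    (L.D f).eval (L.x s) * (L.x (s + 1 / 2) - L.x (s - 1 / 2)) =
      f.eval (L.x (s + 1 / 2)) - f.eval (L.x (s - 1 / 2)) :=
  (L.existsUnique_divDiff f).choose_spec.1 s

/-- The averaging operator `𝕊ₓ` on polynomials: `𝕊ₓ f` is the polynomial with
`(𝕊ₓ f)(x(s)) = (f(x(s + 1/2)) + f(x(s - 1/2))) / 2`. -/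
noncomputable def S (L : QLattice) (f : ℂ[X]) : ℂ[X] := (L.existsUnique_mean f).choose

theorem S_spec (L : QLattice) (f : ℂ[X]) (s : ℂ) :
    (L.S f).eval (L.x s) = (f.eval (L.x (s + 1 / 2)) + f.eval (L.x (s - 1 / 2))) / 2 :=
  (L.existsUnique_mean f).choose_spec.1 s

end QLattice

/-- `P` is a sequence of polynomials, `deg (P n) = n`, orthogonal with respect to the positive
measure `μ` on the real line (for a weight function `w`, `dμ = w(x) dx`). -/
structure IsOrthogonalSeq (μ : Measure ℝ) (P : ℕ → ℝ[X]) : Prop where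
  integrable_pow : ∀ k : ℕ, Integrable (fun t : ℝ => t ^ k) μ
  natDegree_eq : ∀ n, (P n).natDegree = n
  integral_eq_zero : ∀ m n, m ≠ n → ∫ t, (P m).eval t * (P n).eval t ∂μ = 0
  integral_pos : ∀ n, 0 < ∫ t, (P n).eval t * (P n).eval t ∂μ

/-- The family `{Q n}_{n ≥ 2}` is orthogonal with respect to `π dμ`. -/
def IsOrthogonalFromTwo (μ : Measure ℝ) (π : ℂ[X]) (Q : ℕ → ℂ[X]) : Prop :=
  (∀ m n, 2 ≤ m → 2 ≤ n → m ≠ n →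
    ∫ t : ℝ, (Q m).eval (t : ℂ) * (Q n).eval (t : ℂ) * π.eval (t : ℂ) ∂μ = 0) ∧
  ∀ n, 2 ≤ n → ∫ t : ℝ, (Q n).eval (t : ℂ) * (Q n).eval (t : ℂ) * π.eval (t : ℂ) ∂μ ≠ 0

/-- A real polynomial regarded as a complex polynomial. -/
noncomputable def toComplexPoly (p : ℝ[X]) : ℂ[X] := p.map (algebraMap ℝ ℂ)

/-! Adjoin to the polynomials in x = x(s) the half difference ω of the two neighbouring lattice
points, with ω² = U. For the neighbour y = A + ω one has f(y) = S f + ω D f, so the product rules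
for `S` and `D` are the components of the multiplicativity of `ev`. The relation between x and y is
symmetric, hence the ring `Pair` is also free with basis 1, x over the polynomials in y.

Conditions (b) and (c) both amount to one statement on the moment functional u: there is a nonzero F
= φ + ψω with deg φ ≤ 2, deg ψ ≤ 1 and u(φ D p + ψ S p) = 0 for all p (`Pearson`). Such solutions,
without the degree bounds, form a module over the polynomials in y, of rank at most one because u is
regular (`Pearson.coord_proportional`, `Pearson.exists_generator`).

Pearson and (c): the failure of φD² + ψSD to be symmetric is a Pearson expression
(`apply_bochner_sub`). For a solution F the operator is symmetric and does not raise degrees, so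
each P_n is an eigenvector. Conversely, eigenvectors from some index on give the Pearson equation
against all late P_n, and the recurrence carries it down to every index (`pearson_of_bochner_eq`).

Pearson to (b): take π = φ² - Uψ², the norm of F. Then the adjoint of f ↦ π g D²f at 1 is a
polynomial of degree exactly deg g + 2 (`Pearson.exists_adjoint`, `Pearson.lead_ne_zero`).

(b) to Pearson: orthogonality to D²P_2 and D²P_3 produces two solutions, Z = ζ + ρω, whose degree is
one too high, and Y = π + (A(y) - x)Z (`pearson_of_second_adjoint`). Either Z is divisible by a
nonconstant polynomial in y, and dividing lowers its degree, or Y = g(y)Z, and then coprimality of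
P_2 and P_3 forces π = 0 (`exists_pearson_degreeLE_one`).

(a) and (b) are related by expanding π D²P_n in the P_m. -/

/-- The data of a lattice: the mean of two neighbouring points is `α x + β`, and the square of half
their difference is a quadratic polynomial in the midpoint determined by `α`, `β` and `υ`. -/
structure LatticeData where
  (α β υ : ℂ)

/-! ### The ring of two neighbouring lattice points. -/

namespace LatticeData

variable (K : LatticeData)

/-- The mean of two neighbouring lattice points, as a polynomial in the midpoint. -/
noncomputable def A : ℂ[X] := C K.α * X + C K.β

/-- The square of half the difference of two neighbouring lattice points. -/
noncomputable def U : ℂ[X] :=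
  C (K.α ^ 2 - 1) * X ^ 2 + C (2 * K.β * (K.α + 1)) * X + C K.υ

/-- The ring of functions of two neighbouring lattice points, free over the polynomials in the
first one. -/
abbrev Pair : Type := QuadraticAlgebra ℂ[X] K.U 0

/-- The neighbouring lattice point. -/
noncomputable def y : K.Pair := ⟨K.A, 1⟩

/-- Polynomials in the neighbouring lattice point. -/
noncomputable def ev : ℂ[X] →ₐ[ℂ] K.Pair := aeval K.y

/-- Polynomials in the lattice point. -/
noncomputable abbrev ι : ℂ[X] →+* K.Pair := algebraMap ℂ[X] K.Pair

/-- The averaging operator. -/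
noncomputable def S : ℂ[X] →ₗ[ℂ] ℂ[X] where
  toFun p := (K.ev p).re
  map_add' p q := by simp
  map_smul' c p := by simp

/-- The divided difference operator. -/
noncomputable def D : ℂ[X] →ₗ[ℂ] ℂ[X] where
  toFun p := (K.ev p).im
  map_add' p q := by simp
  map_smul' c p := by simp

theorem ev_re (p : ℂ[X]) : (K.ev p).re = K.S p := rfl

theorem ev_im (p : ℂ[X]) : (K.ev p).im = K.D p := rfl

theorem ev_eq (p : ℂ[X]) : K.ev p = ⟨K.S p, K.D p⟩ := rfl

theorem ev_X : K.ev X = K.y := aeval_X _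

theorem ev_C (c : ℂ) : K.ev (C c) = K.ι (C c) := by
  rw [ev, aeval_C]; rfl

theorem S_C (c : ℂ) : K.S (C c) = C c := by
  rw [← ev_re, ev_C]; rfl

theorem D_C (c : ℂ) : K.D (C c) = 0 := by
  rw [← ev_im, ev_C]; rfl

theorem S_one : K.S 1 = 1 := by simpa using K.S_C 1

theorem D_one : K.D 1 = 0 := by simpa using K.D_C 1

theorem S_X : K.S X = K.A := by rw [← ev_re, ev_X]; rfl

theorem D_X : K.D X = 1 := by rw [← ev_im, ev_X]; rfl

theorem S_mul (p q : ℂ[X]) : K.S (p * q) = K.S p * K.S q + K.U * K.D p * K.D q := by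
  rw [← ev_re, map_mul]; rfl

theorem D_mul (p q : ℂ[X]) : K.D (p * q) = K.S p * K.D q + K.D p * K.S q := by
  rw [← ev_im, map_mul, QuadraticAlgebra.im_mul]; simp [ev_eq]

theorem S_C_mul (c : ℂ) (p : ℂ[X]) : K.S (C c * p) = C c * K.S p := by
  rw [S_mul, S_C, D_C]; ring

theorem D_C_mul (c : ℂ) (p : ℂ[X]) : K.D (C c * p) = C c * K.D p := by
  rw [D_mul, S_C, D_C]; ring

theorem S_X_mul (p : ℂ[X]) : K.S (X * p) = K.A * K.S p + K.U * K.D p := by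
  rw [S_mul, S_X, D_X]; ring

theorem D_X_mul (p : ℂ[X]) : K.D (X * p) = K.A * K.D p + K.S p := by
  rw [D_mul, S_X, D_X]; ring

theorem S_A : K.S K.A = C K.α * K.A + C K.β := by
  conv_lhs => rw [A]
  rw [map_add, S_C_mul, S_X, S_C]

theorem D_A : K.D K.A = C K.α := by
  conv_lhs => rw [A]
  rw [map_add, D_C_mul, D_X, D_C]; ring

theorem U_eq : K.U = (C K.α ^ 2 - 1) * X ^ 2 + 2 * C K.β * (C K.α + 1) * X + C K.υ := by
  simp only [U, C_sub, C_add, C_mul, C_pow, C_1, map_ofNat]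

theorem ev_A : K.ev K.A = ⟨C K.α * K.A + C K.β, C K.α⟩ := by
  rw [ev_eq, S_A, D_A]

/-- The deviation of the second mean from the midpoint. -/
noncomputable def V : ℂ[X] := C K.α * K.A + C K.β - X

theorem ev_A_sub : K.ev K.A - K.ι X = ⟨K.V, C K.α⟩ := by
  rw [ev_A, QuadraticAlgebra.algebraMap_eq]
  ext1
  · rfl
  · exact sub_zero _

theorem V_eq : K.V = (C K.α ^ 2 - 1) * X + C K.β * (C K.α + 1) := by
  rw [V, A]; ring

/-- This is why U has only υ as a free parameter: (y - A(x))² = U(x) expands to x² + y² - 2αxy -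
2β(x + y) + β² = υ, which is symmetric in x and y. -/
theorem ev_U : K.ev K.U = (K.ev K.A - K.ι X) ^ 2 := by
  rw [ev_A_sub, pow_two, QuadraticAlgebra.mk_mul_mk, ev_eq]
  have hX : K.S (X ^ 2) = K.A ^ 2 + K.U := by rw [pow_two, S_X_mul, S_X, D_X]; ring
  have hX' : K.D (X ^ 2) = 2 * K.A := by rw [pow_two, D_X_mul, S_X, D_X]; ring
  have hS : K.S K.U = (C K.α ^ 2 - 1) * (K.A ^ 2 + K.U) + 2 * C K.β * (C K.α + 1) * K.A + C K.υ := by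
    conv_lhs => rw [U]
    rw [map_add, map_add, S_C_mul, S_C_mul, S_X, hX, S_C]
    simp only [C_sub, C_add, C_mul, C_pow, C_1, map_ofNat]
  have hD : K.D K.U = (C K.α ^ 2 - 1) * (2 * K.A) + 2 * C K.β * (C K.α + 1) := by
    conv_lhs => rw [U]
    rw [map_add, map_add, D_C_mul, D_C_mul, D_X, hX', D_C]
    simp only [C_sub, C_add, C_mul, C_pow, C_1, map_ofNat]
    ring
  rw [hS, hD, V_eq]
  ext1
  · dsimp only
    rw [U_eq, A]
    ring
  · dsimp only
    rw [A]
    ring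

/-- The decomposition of a polynomial in the lattice point over the polynomials in its neighbour. -/
theorem ι_eq (f : ℂ[X]) : K.ι f = K.ev (K.S f) - (K.ev K.A - K.ι X) * K.ev (K.D f) := by
  induction f using Polynomial.induction_on' with
  | add f g hf hg => simp only [map_add, hf, hg]; ring
  | monomial n a =>
    rw [← C_mul_X_pow_eq_monomial]
    induction n with
    | zero => simp [S_C, D_C, ev_C]
    | succ n ih =>
      have h : C a * X ^ (n + 1) = X * (C a * X ^ n) := by ring
      rw [h, S_X_mul, D_X_mul, map_mul, ih]
      simp only [map_add, map_mul]
      have := K.ev_U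
      simp only [map_mul] at ih
      linear_combination (-K.ev (K.D (C a * X ^ n))) * this

/-- This and `D_S` are the two components of `ι_eq`, which returns from y to x. -/
theorem S_S (f : ℂ[X]) :
    K.S (K.S f) = f + K.V * K.S (K.D f) + C K.α * K.U * K.D (K.D f) := by
  have h := congrArg QuadraticAlgebra.re (K.ι_eq f)
  rw [ev_A_sub, ev_eq, ev_eq, QuadraticAlgebra.mk_mul_mk, QuadraticAlgebra.algebraMap_eq,
    QuadraticAlgebra.re_sub] at h
  simp only at h
  linear_combination -h

theorem D_S (f : ℂ[X]) : K.D (K.S f) = K.V * K.D (K.D f) + C K.α * K.S (K.D f) := by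
  have h := congrArg QuadraticAlgebra.im (K.ι_eq f)
  rw [ev_A_sub, ev_eq, ev_eq, QuadraticAlgebra.mk_mul_mk, QuadraticAlgebra.algebraMap_eq,
    QuadraticAlgebra.im_sub] at h
  simp only at h
  linear_combination -h

/-- The coordinate along `x` of an element over the polynomials in the neighbouring point. -/
noncomputable def coordX (F : K.Pair) : ℂ[X] := K.D (F.re - K.A * F.im) + X * K.D F.im

/-- The coordinate along `1` of an element over the polynomials in the neighbouring point. -/
noncomputable def coordOne (F : K.Pair) : ℂ[X] :=
  K.S (F.re - K.A * F.im) - K.A * K.D (F.re - K.A * F.im) + X * (K.S F.im - K.A * K.D F.im)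

theorem eq_coord (F : K.Pair) : F = K.ev (K.coordOne F) + K.ι X * K.ev (K.coordX F) := by
  -- In the basis 1, y over the polynomials in x, F has coefficients re - A·im and im; `ι_eq`
  -- rewrites both over the polynomials in y.
  have h1 : F = K.ι (F.re - K.A * F.im) + K.y * K.ι F.im := by
    rw [y, QuadraticAlgebra.algebraMap_eq, QuadraticAlgebra.algebraMap_eq,
      QuadraticAlgebra.mk_mul_mk]
    ext1
    · simp
    · simp
  rw [← ev_X, K.ι_eq (F.re - K.A * F.im), K.ι_eq F.im] at h1
  conv_lhs => rw [h1]
  simp only [coordX, coordOne, map_add, map_sub, map_mul]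
  ring

end LatticeData

/-! ### Leading coefficients of `S` and `D`, and surjectivity of `D`. -/

theorem Polynomial.natDegree_sub_C_mul_X_pow_le {p : ℂ[X]} {n : ℕ} (h : p.natDegree ≤ n + 1) :
    (p - C (p.coeff (n + 1)) * X ^ (n + 1)).natDegree ≤ n := by
  rw [natDegree_le_iff_coeff_eq_zero]
  intro m hm
  rw [coeff_sub, coeff_C_mul_X_pow]
  split_ifs with hmn
  · rw [hmn, sub_self]
  · rw [coeff_eq_zero_of_natDegree_lt (by omega), sub_zero]

namespace LatticeData

variable (K : LatticeData)

/-- The leading coefficients of the divided difference and of the mean of `X ^ n`. -/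
noncomputable def lead : ℕ → ℂ × ℂ
  | 0 => (0, 1)
  | n + 1 => (K.α * (lead n).1 + (lead n).2, K.α * (lead n).2 + (K.α ^ 2 - 1) * (lead n).1)

/-- The leading coefficient of the divided difference of `X ^ n`. -/
noncomputable def γ (n : ℕ) : ℂ := (K.lead n).1

/-- The leading coefficient of the mean of `X ^ n`. -/
noncomputable def σ (n : ℕ) : ℂ := (K.lead n).2

theorem γ_zero : K.γ 0 = 0 := rfl

theorem σ_zero : K.σ 0 = 1 := rfl

theorem γ_succ (n : ℕ) : K.γ (n + 1) = K.α * K.γ n + K.σ n := rfl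

theorem σ_succ (n : ℕ) : K.σ (n + 1) = K.α * K.σ n + (K.α ^ 2 - 1) * K.γ n := rfl

theorem γ_one : K.γ 1 = 1 := by rw [γ_succ, γ_zero, σ_zero]; ring

theorem σ_one : K.σ 1 = K.α := by rw [σ_succ, γ_zero, σ_zero]; ring

theorem γ_two : K.γ 2 = 2 * K.α := by rw [γ_succ, γ_one, σ_one]; ring

theorem natDegree_A : K.A.natDegree ≤ 1 := natDegree_linear_le

theorem coeff_A : K.A.coeff 1 = K.α := by simp [A, coeff_C]

theorem natDegree_U : K.U.natDegree ≤ 2 := natDegree_quadratic_le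

theorem coeff_U : K.U.coeff 2 = K.α ^ 2 - 1 := by
  rw [U]
  simp only [coeff_add, coeff_C_mul, coeff_X_pow, coeff_X, coeff_C]
  norm_num

theorem S_D_X_pow (n : ℕ) :
    ((K.S (X ^ (n + 1))).natDegree ≤ n + 1 ∧ (K.S (X ^ (n + 1))).coeff (n + 1) = K.σ (n + 1)) ∧
    ((K.D (X ^ (n + 1))).natDegree ≤ n ∧ (K.D (X ^ (n + 1))).coeff n = K.γ (n + 1)) := by
  induction n with
  | zero =>
    rw [zero_add, pow_one, S_X, D_X, γ_one, σ_one]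
    exact ⟨⟨K.natDegree_A, K.coeff_A⟩, by simp, by simp⟩
  | succ n ih =>
    obtain ⟨⟨h1, h2⟩, h3, h4⟩ := ih
    have hA := K.natDegree_A
    have hU := K.natDegree_U
    have e1 : n + 1 + 1 = 1 + (n + 1) := by ring
    have e2 : n + 1 + 1 = 2 + n := by ring
    rw [pow_succ' X (n + 1), S_X_mul, D_X_mul, K.γ_succ (n + 1), K.σ_succ (n + 1)]
    refine ⟨⟨?_, ?_⟩, ?_, ?_⟩
    · refine natDegree_add_le_of_degree_le ?_ ?_
      · exact natDegree_mul_le.trans (by omega)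
      · exact natDegree_mul_le.trans (by omega)
    · rw [coeff_add]
      congr 1
      · rw [e1, coeff_mul_add_eq_of_natDegree_le hA h1, coeff_A, h2]
      · rw [e2, coeff_mul_add_eq_of_natDegree_le hU h3, coeff_U, h4]
    · refine natDegree_add_le_of_degree_le ?_ h1
      exact natDegree_mul_le.trans (by omega)
    · have h := coeff_mul_add_eq_of_natDegree_le hA h3
      rw [coeff_A, h4, add_comm 1 n] at h
      rw [coeff_add, h, h2]

theorem natDegree_S_coeff {p : ℂ[X]} {n : ℕ} (hp : p.natDegree ≤ n) :
    (K.S p).natDegree ≤ n ∧ (K.S p).coeff n = K.σ n * p.coeff n := by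
  induction n generalizing p with
  | zero =>
    rw [eq_C_of_natDegree_le_zero hp, S_C, σ_zero]
    simp
  | succ n ih =>
    obtain ⟨h1, -⟩ := ih (natDegree_sub_C_mul_X_pow_le hp)
    obtain ⟨⟨h2, h3⟩, -⟩ := K.S_D_X_pow n
    have h : K.S p = K.S (p - C (p.coeff (n + 1)) * X ^ (n + 1)) +
        C (p.coeff (n + 1)) * K.S (X ^ (n + 1)) := by
      rw [← S_C_mul, ← map_add, sub_add_cancel]
    rw [h]
    refine ⟨natDegree_add_le_of_degree_le (by omega) ((natDegree_C_mul_le _ _).trans h2), ?_⟩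
    rw [coeff_add, coeff_C_mul, h3, coeff_eq_zero_of_natDegree_lt (by omega)]
    ring

theorem D_of_natDegree_eq_zero {p : ℂ[X]} (hp : p.natDegree ≤ 0) : K.D p = 0 := by
  rw [eq_C_of_natDegree_le_zero hp, D_C]

theorem natDegree_D_coeff {p : ℂ[X]} {n : ℕ} (hp : p.natDegree ≤ n + 1) :
    (K.D p).natDegree ≤ n ∧ (K.D p).coeff n = K.γ (n + 1) * p.coeff (n + 1) := by
  have hr := natDegree_sub_C_mul_X_pow_le hp
  have hD : (K.D (p - C (p.coeff (n + 1)) * X ^ (n + 1))).natDegree ≤ n ∧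
      (K.D (p - C (p.coeff (n + 1)) * X ^ (n + 1))).coeff n = 0 := by
    generalize p - C (p.coeff (n + 1)) * X ^ (n + 1) = r at hr ⊢
    clear hp
    induction n generalizing r with
    | zero => rw [K.D_of_natDegree_eq_zero hr]; simp
    | succ n ih =>
      obtain ⟨h1, -⟩ := ih _ (natDegree_sub_C_mul_X_pow_le hr)
      obtain ⟨-, h3, -⟩ := K.S_D_X_pow n
      have h : K.D r = K.D (r - C (r.coeff (n + 1)) * X ^ (n + 1)) +
          C (r.coeff (n + 1)) * K.D (X ^ (n + 1)) := by
        rw [← D_C_mul, ← map_add, sub_add_cancel]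
      have hle : (K.D r).natDegree ≤ n := by
        rw [h]
        exact natDegree_add_le_of_degree_le h1 ((natDegree_C_mul_le _ _).trans h3)
      exact ⟨by omega, coeff_eq_zero_of_natDegree_lt (by omega)⟩
  obtain ⟨-, h3, h4⟩ := K.S_D_X_pow n
  have h : K.D p = K.D (p - C (p.coeff (n + 1)) * X ^ (n + 1)) +
      C (p.coeff (n + 1)) * K.D (X ^ (n + 1)) := by
    rw [← D_C_mul, ← map_add, sub_add_cancel]
  rw [h]
  refine ⟨natDegree_add_le_of_degree_le hD.1 ((natDegree_C_mul_le _ _).trans h3), ?_⟩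
  rw [coeff_add, coeff_C_mul, h4, hD.2]
  ring

/-- The divided difference lowers every degree by exactly one. -/
def Nondegenerate : Prop := ∀ n, K.γ (n + 1) ≠ 0

variable {K}

theorem Nondegenerate.α_ne_zero (hK : K.Nondegenerate) : K.α ≠ 0 := by
  have h := hK 1
  rw [γ_two] at h
  exact right_ne_zero_of_mul h

theorem Nondegenerate.exists_D_eq (hK : K.Nondegenerate) (n : ℕ) (p : ℂ[X])
    (hp : p.natDegree ≤ n) :
    ∃ h : ℂ[X], K.D h = p ∧ h.natDegree ≤ n + 1 ∧ K.γ (n + 1) * h.coeff (n + 1) = p.coeff n := by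
  suffices ∃ h : ℂ[X], K.D h = p ∧ h.natDegree ≤ n + 1 by
    obtain ⟨h, rfl, h2⟩ := this
    exact ⟨h, rfl, h2, (K.natDegree_D_coeff h2).2.symm⟩
  induction n generalizing p with
  | zero =>
    refine ⟨p * X, ?_, natDegree_mul_le.trans (by simp; omega)⟩
    rw [eq_C_of_natDegree_le_zero hp, D_C_mul, D_X, mul_one]
  | succ n ih =>
    have hq : (C (p.coeff (n + 1) / K.γ (n + 2)) * X ^ (n + 2) : ℂ[X]).natDegree ≤ n + 2 :=
      natDegree_C_mul_X_pow_le _ _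
    obtain ⟨h1, h2⟩ := K.natDegree_D_coeff hq
    have hc : (p - K.D (C (p.coeff (n + 1) / K.γ (n + 2)) * X ^ (n + 2))).natDegree ≤ n := by
      have h3 : (p - K.D (C (p.coeff (n + 1) / K.γ (n + 2)) * X ^ (n + 2))).coeff (n + 1) = 0 := by
        rw [coeff_sub, h2, coeff_C_mul_X_pow, if_pos rfl, mul_div_cancel₀ _ (hK (n + 1)), sub_self]
      have h4 : (p - K.D (C (p.coeff (n + 1) / K.γ (n + 2)) * X ^ (n + 2))).natDegree ≤ n + 1 :=
        (natDegree_sub_le _ _).trans (max_le hp h1)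
      have h5 := natDegree_sub_C_mul_X_pow_le h4
      rwa [h3, C_0, zero_mul, sub_zero] at h5
    obtain ⟨h, h6, h7⟩ := ih _ hc
    refine ⟨h + C (p.coeff (n + 1) / K.γ (n + 2)) * X ^ (n + 2), ?_,
      natDegree_add_le_of_degree_le (by omega) hq⟩
    rw [map_add, h6, sub_add_cancel]

theorem Nondegenerate.D_surjective (hK : K.Nondegenerate) : Function.Surjective K.D := fun p =>
  let ⟨h, hp, _⟩ := hK.exists_D_eq p.natDegree p le_rfl
  ⟨h, hp⟩

end LatticeData

/-! ### Division by polynomials in the neighbouring point. -/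

namespace LatticeData

variable {K : LatticeData}

/-- Pairs of polynomials of degree at most `d + 1` and `d`. -/
def DegreeLE (F : K.Pair) (d : ℕ) : Prop := F.re.natDegree ≤ d + 1 ∧ F.im.natDegree ≤ d

theorem DegreeLE.mono {F : K.Pair} {d e : ℕ} (h : DegreeLE F d) (hde : d ≤ e) : DegreeLE F e :=
  ⟨h.1.trans (by omega), h.2.trans hde⟩

variable (K) in
-- This is the norm of y - r. Its leading coefficient is α² - (α² - 1) = 1 for every α, so the
-- degree count for division by y - r is uniform.
theorem norm_monic (r : ℂ) :
    ((K.A - C r) ^ 2 - K.U).natDegree = 2 ∧ ((K.A - C r) ^ 2 - K.U).Monic := by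
  have hd : ((K.A - C r) ^ 2 - K.U) = C 1 * X ^ 2 + C (-2 * (K.α * r + K.β)) * X +
      C ((K.β - r) ^ 2 - K.υ) := by
    simp only [A, U_eq, C_sub, C_add, C_mul, C_pow, C_neg, C_1, map_ofNat]
    ring
  rw [hd]
  exact ⟨natDegree_quadratic one_ne_zero, leadingCoeff_quadratic one_ne_zero⟩

theorem ev_X_sub_C_mul (r : ℂ) (F : K.Pair) :
    K.ev (X - C r) * F = ⟨(K.A - C r) * F.re + K.U * F.im, F.re + (K.A - C r) * F.im⟩ := by
  rw [map_sub, ev_X, ev_C, y, QuadraticAlgebra.algebraMap_eq]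
  ext1
  · simp
  · simp; ring

theorem eq_zero_of_ev_X_sub_C_mul {r : ℂ} {F : K.Pair} (h : K.ev (X - C r) * F = 0) : F = 0 := by
  rw [ev_X_sub_C_mul] at h
  have h1 : (K.A - C r) * F.re + K.U * F.im = 0 := congrArg QuadraticAlgebra.re h
  have h2 : F.re + (K.A - C r) * F.im = 0 := congrArg QuadraticAlgebra.im h
  have hN := (K.norm_monic r).2.ne_zero
  have h3 : ((K.A - C r) ^ 2 - K.U) * F.im = 0 := by linear_combination (K.A - C r) * h2 - h1
  have h4 : F.im = 0 := (mul_eq_zero.1 h3).resolve_left hN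
  rw [h4] at h2
  ext1
  · simpa using h2
  · exact h4

theorem Polynomial.exists_eq_X_sub_C_mul {p : ℂ[X]} {n : ℕ} (hp : p.natDegree = n + 1) :
    ∃ r q, p = (X - C r) * q ∧ q.natDegree = n := by
  obtain ⟨r, hr⟩ := IsAlgClosed.exists_root p
    (by rw [degree_eq_natDegree (by rintro rfl; simp at hp), hp]; exact_mod_cast n.succ_ne_zero)
  obtain ⟨q, rfl⟩ := dvd_iff_isRoot.2 hr
  refine ⟨r, q, rfl, ?_⟩
  rw [(monic_X_sub_C r).natDegree_mul' (by rintro rfl; simp at hp), natDegree_X_sub_C] at hp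
  omega

theorem eq_zero_of_ev_mul {p : ℂ[X]} {F : K.Pair} (hp : p ≠ 0) (h : K.ev p * F = 0) : F = 0 := by
  obtain ⟨n, hn⟩ : ∃ n, p.natDegree = n := ⟨_, rfl⟩
  induction n generalizing p F with
  | zero =>
    rw [eq_C_of_natDegree_eq_zero hn] at h hp
    have hc : p.coeff 0 ≠ 0 := fun h0 => hp (by rw [h0, C_0])
    have h' : K.ev (C (p.coeff 0)⁻¹) * (K.ev (C (p.coeff 0)) * F) = 0 := by rw [h, mul_zero]
    rwa [← mul_assoc, ← map_mul, ← C_mul, inv_mul_cancel₀ hc, C_1, map_one, one_mul] at h'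
  | succ n ih =>
    obtain ⟨r, q, rfl, hq⟩ := Polynomial.exists_eq_X_sub_C_mul hn
    rw [map_mul, mul_assoc] at h
    exact ih (right_ne_zero_of_mul hp) (eq_zero_of_ev_X_sub_C_mul h) hq

/-- Multiplying by the conjugate A - r - ω raises the degree by at most one, and cancelling the
monic norm lowers it by two. -/
theorem DegreeLE.of_ev_X_sub_C_mul {r : ℂ} {F : K.Pair} {d : ℕ}
    (h : DegreeLE (K.ev (X - C r) * F) (d + 1)) : DegreeLE F d := by
  rw [ev_X_sub_C_mul] at h
  obtain ⟨h1, h2⟩ := h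
  simp only at h1 h2
  obtain ⟨hN, hM⟩ := K.norm_monic r
  have hA : (K.A - C r).natDegree ≤ 1 := (natDegree_sub_le _ _).trans (max_le K.natDegree_A (by simp))
  have hU := K.natDegree_U
  generalize hH1 : (K.A - C r) * F.re + K.U * F.im = H1 at h1
  generalize hH2 : F.re + (K.A - C r) * F.im = H2 at h2
  have e1 : ((K.A - C r) ^ 2 - K.U) * F.re = (K.A - C r) * H1 - K.U * H2 := by
    rw [← hH1, ← hH2]; ring
  have e2 : ((K.A - C r) ^ 2 - K.U) * F.im = (K.A - C r) * H2 - H1 := by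
    rw [← hH1, ← hH2]; ring
  have key : ∀ (g : ℂ[X]) (m : ℕ), (((K.A - C r) ^ 2 - K.U) * g).natDegree ≤ m + 2 →
      g.natDegree ≤ m := by
    intro g m hg
    rcases eq_or_ne g 0 with rfl | h0
    · simp
    · rw [hM.natDegree_mul' h0, hN] at hg
      omega
  constructor
  · refine key _ _ ?_
    rw [e1]
    refine (natDegree_sub_le _ _).trans
      (max_le (natDegree_mul_le.trans ?_) (natDegree_mul_le.trans ?_)) <;> omega
  · refine key _ _ ?_
    rw [e2]
    refine (natDegree_sub_le _ _).trans (max_le (natDegree_mul_le.trans ?_) ?_) <;> omega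

theorem DegreeLE.of_ev_mul {p : ℂ[X]} {F : K.Pair} {d : ℕ} (hp : p ≠ 0)
    (h : DegreeLE (K.ev p * F) d) : DegreeLE F d := by
  obtain ⟨n, hn⟩ : ∃ n, p.natDegree = n := ⟨_, rfl⟩
  induction n generalizing p F with
  | zero =>
    rw [eq_C_of_natDegree_eq_zero hn] at h hp
    have hc : p.coeff 0 ≠ 0 := fun h0 => hp (by rw [h0, C_0])
    have h' : F = K.ι (C (p.coeff 0)⁻¹) * (K.ev (C (p.coeff 0)) * F) := by
      rw [ev_C, ← mul_assoc, ← map_mul, ← C_mul, inv_mul_cancel₀ hc, C_1, map_one, one_mul]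
    generalize K.ev (C (p.coeff 0)) * F = G at h h'
    rw [h', QuadraticAlgebra.algebraMap_eq, DegreeLE]
    simp only [QuadraticAlgebra.re_mul, QuadraticAlgebra.im_mul, mul_zero, zero_mul, add_zero]
    exact ⟨(natDegree_C_mul_le _ _).trans h.1, (natDegree_C_mul_le _ _).trans h.2⟩
  | succ n ih =>
    obtain ⟨r, q, rfl, hq⟩ := Polynomial.exists_eq_X_sub_C_mul hn
    rw [map_mul, mul_assoc] at h
    exact ih (right_ne_zero_of_mul hp)
      (DegreeLE.of_ev_X_sub_C_mul (h.mono (Nat.le_succ d))) hq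

theorem DegreeLE.of_ev_mul_of_natDegree_pos {p : ℂ[X]} {F : K.Pair} {d : ℕ}
    (hp : 0 < p.natDegree) (h : DegreeLE (K.ev p * F) (d + 1)) : DegreeLE F d := by
  obtain ⟨n, hn⟩ : ∃ n, p.natDegree = n + 1 := ⟨p.natDegree - 1, by omega⟩
  obtain ⟨r, q, rfl, hq⟩ := Polynomial.exists_eq_X_sub_C_mul hn
  have h0 : (X - C r) * q ≠ 0 := by rintro h0; simp [h0] at hp
  rw [map_mul, mul_assoc] at h
  exact DegreeLE.of_ev_mul (right_ne_zero_of_mul h0) (DegreeLE.of_ev_X_sub_C_mul h)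

/-! ### The module of solutions of the Pearson equation. -/

/-- The pair `F = (φ, ψ)` satisfies the Pearson equation for the functional `u`: `u` annihilates
`φ D p + ψ S p` for all polynomials `p`. -/
def Pearson (u : ℂ[X] →ₗ[ℂ] ℂ) (F : K.Pair) : Prop := ∀ p, u (F * K.ev p).im = 0

/-- The functional is not annihilated by any nonzero polynomial. -/
def Regular (u : ℂ[X] →ₗ[ℂ] ℂ) : Prop := ∀ f : ℂ[X], (∀ g, u (f * g) = 0) → f = 0

variable {u : ℂ[X] →ₗ[ℂ] ℂ}

theorem pearson_iff (F : K.Pair) :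
    Pearson u F ↔ ∀ p, u (F.re * K.D p + F.im * K.S p) = 0 := by
  refine forall_congr' fun p => ?_
  rw [QuadraticAlgebra.im_mul, ev_re, ev_im, zero_mul, zero_mul, add_zero]

theorem Pearson.add {F G : K.Pair} (hF : Pearson u F) (hG : Pearson u G) : Pearson u (F + G) := by
  intro p
  rw [add_mul, QuadraticAlgebra.im_add, map_add, hF p, hG p, add_zero]

theorem Pearson.ev_mul {F : K.Pair} (hF : Pearson u F) (q : ℂ[X]) : Pearson u (K.ev q * F) := by
  intro p
  rw [mul_comm (K.ev q), mul_assoc, ← map_mul]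
  exact hF _

/-- Regularity makes the pairing (F, G) ↦ u(im(FG)) nondegenerate. -/
theorem Regular.eq_zero (hu : Regular u) {F : K.Pair} (h : ∀ G, u (F * G).im = 0) : F = 0 := by
  have h1 : F.im = 0 := hu _ fun g => by
    have := h ⟨g, 0⟩
    simpa using this
  have h2 : F.re = 0 := hu _ fun g => by
    have := h ⟨0, g⟩
    simpa using this
  ext1
  · exact h2
  · exact h1

/-- Two solutions of the Pearson equation are proportional over the polynomials in the neighbouring
lattice point. -/
theorem Pearson.coord_proportional (hu : Regular u) {F G : K.Pair} (hF : Pearson u F)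
    (hG : Pearson u G) : K.coordOne F * K.coordX G = K.coordOne G * K.coordX F := by
  have eF := K.eq_coord F
  have eG := K.eq_coord G
  generalize K.coordOne F = a, K.coordX F = b, K.coordOne G = c, K.coordX G = d at eF eG ⊢
  by_contra hne
  have hne' : a * d - c * b ≠ 0 := sub_ne_zero.2 hne
  -- Cramer's rule: if the determinant were nonzero, its products with both basis elements 1 and x
  -- would be solutions, so all its multiples would be annihilated.
  have h1 : K.ev (a * d - c * b) = K.ev d * F + K.ev (-b) * G := by
    rw [eF, eG]; simp only [map_sub, map_mul, map_neg]; ring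
  have h2 : K.ev (a * d - c * b) * K.ι X = K.ev a * G + K.ev (-c) * F := by
    rw [eF, eG]; simp only [map_sub, map_mul, map_neg]; ring
  have h3 : Pearson u (K.ev (a * d - c * b)) := by
    rw [h1]; exact (hF.ev_mul _).add (hG.ev_mul _)
  have h4 : Pearson u (K.ev (a * d - c * b) * K.ι X) := by
    rw [h2]; exact (hG.ev_mul _).add (hF.ev_mul _)
  have h5 : K.ev (a * d - c * b) = 0 := hu.eq_zero fun H => by
    rw [K.eq_coord H, mul_add, ← mul_assoc, QuadraticAlgebra.im_add, map_add, h3, h4, add_zero]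
  exact one_ne_zero (eq_zero_of_ev_mul (F := (1 : K.Pair)) hne' (by rw [h5, zero_mul]))

/-- Dividing (a, b) by its gcd gives a primitive vector, and Bézout coefficients exhibit any
proportional (c, d) as a multiple of it. -/
theorem Polynomial.exists_eq_mul_of_mul_eq_mul {a b c d : ℂ[X]} (hab : a ≠ 0 ∨ b ≠ 0)
    (h : a * d = c * b) : ∃ g k a' b', a = g * a' ∧ b = g * b' ∧ c = k * a' ∧ d = k * b' := by
  classical
  obtain ⟨a', ha⟩ := EuclideanDomain.gcd_dvd_left a b
  obtain ⟨b', hb⟩ := EuclideanDomain.gcd_dvd_right a b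
  have hg := EuclideanDomain.gcd_eq_gcd_ab a b
  generalize EuclideanDomain.gcdA a b = s, EuclideanDomain.gcdB a b = t at hg
  generalize EuclideanDomain.gcd a b = g at ha hb hg
  have g0 : g ≠ 0 := by
    rintro rfl
    rw [zero_mul] at ha hb
    exact hab.elim (· ha) (· hb)
  have h1 : a' * s + b' * t = 1 := by
    apply mul_left_cancel₀ g0
    rw [ha, hb] at hg
    linear_combination -hg
  have h2 : a' * d = c * b' := by
    apply mul_left_cancel₀ g0
    rw [ha, hb] at h
    linear_combination h
  exact ⟨g, s * c + t * d, a', b', ha, hb, by linear_combination (-c) * h1 - t * h2,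
    by linear_combination (-d) * h1 + s * h2⟩

/-- Two solutions of the Pearson equation are multiples of a third one. -/
theorem Pearson.exists_generator (hu : Regular u) {F G : K.Pair} (hF : Pearson u F)
    (hG : Pearson u G) (h0 : F ≠ 0) :
    ∃ (H : K.Pair) (k h : ℂ[X]), Pearson u H ∧ F = K.ev k * H ∧ G = K.ev h * H := by
  have eF := K.eq_coord F
  have eG := K.eq_coord G
  have hc := hF.coord_proportional hu hG
  generalize K.coordOne F = a, K.coordX F = b, K.coordOne G = c, K.coordX G = d at eF eG hc
  have hab : a ≠ 0 ∨ b ≠ 0 := by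
    by_contra! hab
    rw [hab.1, hab.2] at eF
    simp at eF
    exact h0 eF
  obtain ⟨g, k, a', b', rfl, rfl, rfl, rfl⟩ := Polynomial.exists_eq_mul_of_mul_eq_mul hab hc
  -- The polynomials whose product with the primitive vector is a solution form an ideal; its
  -- generator m yields H.
  let I : Ideal ℂ[X] :=
    { carrier := {q | Pearson u (K.ev q * (K.ev a' + K.ι X * K.ev b'))}
      add_mem' := fun {p q} hp hq => by
        simp only [Set.mem_ofPred_eq, map_add K.ev p q, add_mul] at *
        exact hp.add hq
      zero_mem' := by intro p; simp
      smul_mem' := fun p q hq => by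
        simp only [Set.mem_ofPred_eq, smul_eq_mul, map_mul K.ev p q, mul_assoc] at *
        exact hq.ev_mul p }
  have hg : g ∈ I := by
    have : F = K.ev g * (K.ev a' + K.ι X * K.ev b') := by
      rw [eF]; simp only [map_mul]; ring
    change Pearson u _
    rwa [← this]
  have hk : k ∈ I := by
    have : G = K.ev k * (K.ev a' + K.ι X * K.ev b') := by
      rw [eG]; simp only [map_mul]; ring
    change Pearson u _
    rwa [← this]
  obtain ⟨m, hm⟩ := (IsPrincipalIdealRing.principal I).principal
  have hmI : m ∈ I := by rw [hm]; exact Submodule.mem_span_singleton_self m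
  rw [hm] at hg hk
  obtain ⟨p, rfl⟩ := Submodule.mem_span_singleton.1 hg
  obtain ⟨q, rfl⟩ := Submodule.mem_span_singleton.1 hk
  refine ⟨K.ev m * (K.ev a' + K.ι X * K.ev b'), p, q, hmI, ?_, ?_⟩
  · rw [eF]; simp only [map_mul, smul_eq_mul]; ring
  · rw [eG]; simp only [map_mul, smul_eq_mul]; ring

end LatticeData

/-! ### Orthogonal polynomials for a linear functional. -/

theorem LinearMap.apply_C_mul (u : ℂ[X] →ₗ[ℂ] ℂ) (c : ℂ) (f : ℂ[X]) : u (C c * f) = c * u f := by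
  rw [C_mul', map_smul, smul_eq_mul]

/-- A sequence of polynomials, one of each degree, orthogonal with respect to a linear functional. -/
structure IsOPS (u : ℂ[X] →ₗ[ℂ] ℂ) (p : ℕ → ℂ[X]) : Prop where
  natDegree_eq : ∀ n, (p n).natDegree = n
  apply_mul_eq_zero : ∀ m n, m ≠ n → u (p m * p n) = 0
  apply_mul_ne_zero : ∀ n, u (p n * p n) ≠ 0

namespace IsOPS

variable {u : ℂ[X] →ₗ[ℂ] ℂ} {p : ℕ → ℂ[X]}

theorem ne_zero (hp : IsOPS u p) (n : ℕ) : p n ≠ 0 :=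
  fun h => hp.apply_mul_ne_zero n (by rw [h]; simp)

theorem coeff_ne_zero (hp : IsOPS u p) (n : ℕ) : (p n).coeff n ≠ 0 := by
  have h := leadingCoeff_ne_zero.2 (hp.ne_zero n)
  rwa [leadingCoeff, hp.natDegree_eq] at h

theorem natDegree_sub_le (hp : IsOPS u p) {f : ℂ[X]} {n : ℕ} (hf : f.natDegree ≤ n + 1) :
    (f - C (f.coeff (n + 1) / (p (n + 1)).coeff (n + 1)) * p (n + 1)).natDegree ≤ n := by
  rw [natDegree_le_iff_coeff_eq_zero]
  intro m hm
  rw [coeff_sub, coeff_C_mul]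
  rcases eq_or_ne m (n + 1) with rfl | hmn
  · rw [div_mul_cancel₀ _ (hp.coeff_ne_zero _), sub_self]
  · have h1 : f.coeff m = 0 := coeff_eq_zero_of_natDegree_lt (by omega)
    have h2 : (p (n + 1)).coeff m = 0 :=
      coeff_eq_zero_of_natDegree_lt (by rw [hp.natDegree_eq]; omega)
    rw [h1, h2, mul_zero, sub_zero]

theorem exists_eq_C_mul_zero (hp : IsOPS u p) {f : ℂ[X]} (hf : f.natDegree ≤ 0) :
    f = C (f.coeff 0 / (p 0).coeff 0) * p 0 := by
  conv_rhs => rw [eq_C_of_natDegree_eq_zero (hp.natDegree_eq 0)]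
  rw [← C_mul, coeff_C_zero, div_mul_cancel₀ _ (hp.coeff_ne_zero _)]
  exact eq_C_of_natDegree_le_zero hf

theorem induction_natDegree_le (hp : IsOPS u p) {M : ℂ[X] → Prop}
    (hadd : ∀ f g, M f → M g → M (f + g))
    (hC : ∀ c f, M f → M (C c * f)) {n : ℕ} (h : ∀ j ≤ n, M (p j)) {f : ℂ[X]}
    (hf : f.natDegree ≤ n) : M f := by
  induction n generalizing f with
  | zero =>
    rw [hp.exists_eq_C_mul_zero hf]
    exact hC _ _ (h 0 le_rfl)
  | succ n ih =>
    rw [← sub_add_cancel f (C (f.coeff (n + 1) / (p (n + 1)).coeff (n + 1)) * p (n + 1))]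
    exact hadd _ _ (ih (fun j hj => h j (hj.trans n.le_succ)) (hp.natDegree_sub_le hf))
      (hC _ _ (h _ le_rfl))

theorem apply_mul_of_natDegree_lt (hp : IsOPS u p) {f : ℂ[X]} {n : ℕ} (hf : f.natDegree < n) :
    u (f * p n) = 0 := by
  obtain ⟨m, rfl⟩ : ∃ m, n = m + 1 := ⟨n - 1, by omega⟩
  refine hp.induction_natDegree_le (M := fun f => u (f * p (m + 1)) = 0) (n := m) ?_ ?_ ?_
    (by omega)
  · intro f g hf hg
    rw [add_mul, map_add, hf, hg, add_zero]
  · intro c f hf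
    rw [mul_assoc, LinearMap.apply_C_mul, hf, mul_zero]
  · intro j hj
    exact hp.apply_mul_eq_zero _ _ (by omega)

theorem apply_mul_of_natDegree_le (hp : IsOPS u p) {f : ℂ[X]} {n : ℕ} (hf : f.natDegree ≤ n) :
    u (f * p n) = f.coeff n / (p n).coeff n * u (p n * p n) := by
  rcases Nat.eq_zero_or_pos n with rfl | hn
  · conv_lhs => rw [hp.exists_eq_C_mul_zero hf]
    rw [mul_assoc, LinearMap.apply_C_mul]
  · obtain ⟨m, rfl⟩ : ∃ m, n = m + 1 := ⟨n - 1, by omega⟩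
    conv_lhs => rw [← sub_add_cancel f (C (f.coeff (m + 1) / (p (m + 1)).coeff (m + 1)) * p (m + 1))]
    have := hp.natDegree_sub_le hf
    rw [add_mul, map_add, hp.apply_mul_of_natDegree_lt (by omega), mul_assoc,
      LinearMap.apply_C_mul, zero_add]

theorem apply_mul_ne_zero_of_coeff (hp : IsOPS u p) {f : ℂ[X]} {n : ℕ} (hf : f.natDegree ≤ n)
    (hc : f.coeff n ≠ 0) : u (f * p n) ≠ 0 := by
  rw [hp.apply_mul_of_natDegree_le hf]
  exact mul_ne_zero (div_ne_zero hc (hp.coeff_ne_zero n)) (hp.apply_mul_ne_zero n)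

theorem induction (hp : IsOPS u p) {M : ℂ[X] → Prop} (hadd : ∀ f g, M f → M g → M (f + g))
    (hC : ∀ c f, M f → M (C c * f)) (h : ∀ j, M (p j)) (f : ℂ[X]) : M f :=
  hp.induction_natDegree_le hadd hC (fun j _ => h j) le_rfl

theorem regular (hp : IsOPS u p) : LatticeData.Regular u := by
  intro f hf
  by_contra h0
  refine hp.apply_mul_ne_zero_of_coeff le_rfl ?_ (hf (p f.natDegree))
  exact leadingCoeff_ne_zero.2 h0

/-- A polynomial orthogonal to the polynomials of low degree starts with a later member of the
sequence. -/
theorem eq_zero_of_natDegree_le (hp : IsOPS u p) {f : ℂ[X]} {n : ℕ} (hf : f.natDegree ≤ n)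
    (h : ∀ j ≤ n, u (f * p j) = 0) : f = 0 := by
  by_contra h0
  exact hp.apply_mul_ne_zero_of_coeff le_rfl (leadingCoeff_ne_zero.2 h0) (h _ hf)

theorem eq_C_mul (hp : IsOPS u p) {f : ℂ[X]} {n : ℕ} (hf : f.natDegree ≤ n)
    (h : ∀ j < n, u (f * p j) = 0) : f = C (u (f * p n) / u (p n * p n)) * p n := by
  rw [← sub_eq_zero]
  refine hp.eq_zero_of_natDegree_le (n := n) ?_ ?_
  · exact (Polynomial.natDegree_sub_le _ _).trans
      (max_le hf ((natDegree_C_mul_le _ _).trans (hp.natDegree_eq n).le))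
  · intro j hj
    rw [sub_mul, map_sub, mul_assoc, LinearMap.apply_C_mul]
    rcases hj.lt_or_eq with hj | rfl
    · rw [h j hj, hp.apply_mul_eq_zero n j (by omega), mul_zero, sub_zero]
    · rw [div_mul_cancel₀ _ (hp.apply_mul_ne_zero j), sub_self]

theorem exists_recurrence (hp : IsOPS u p) (n : ℕ) :
    ∃ a b c : ℂ, c ≠ 0 ∧ X * p (n + 1) = C a * p (n + 2) + C b * p (n + 1) + C c * p n := by
  have hX : ∀ m, (X * p m).natDegree = m + 1 := fun m => by
    rw [natDegree_X_mul (hp.ne_zero m), hp.natDegree_eq]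
  refine ⟨u (X * p (n + 1) * p (n + 2)) / u (p (n + 2) * p (n + 2)),
    u (X * p (n + 1) * p (n + 1)) / u (p (n + 1) * p (n + 1)),
    u (X * p (n + 1) * p n) / u (p n * p n), ?_, ?_⟩
  · refine div_ne_zero ?_ (hp.apply_mul_ne_zero n)
    have h : X * p (n + 1) * p n = X * p n * p (n + 1) := by ring
    rw [h]
    refine hp.apply_mul_ne_zero_of_coeff (hX n).le ?_
    rw [coeff_X_mul]
    exact hp.coeff_ne_zero n
  · rw [← sub_eq_zero]
    have hpd := hp.natDegree_eq
    refine hp.eq_zero_of_natDegree_le (n := n + 2) ?_ ?_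
    · refine (Polynomial.natDegree_sub_le _ _).trans (max_le (hX _).le ?_)
      refine natDegree_add_le_of_degree_le (natDegree_add_le_of_degree_le ?_ ?_) ?_ <;>
        refine (natDegree_C_mul_le _ _).trans ?_ <;> rw [hpd]
      all_goals omega
    · intro j hj
      simp only [sub_mul, add_mul, map_sub, map_add, mul_assoc, LinearMap.apply_C_mul]
      have hj' : j < n ∨ j = n ∨ j = n + 1 ∨ j = n + 2 := by omega
      have hne := hp.apply_mul_ne_zero
      have ho := hp.apply_mul_eq_zero
      rcases hj' with hj' | rfl | rfl | rfl
      · have h : X * (p (n + 1) * p j) = X * p j * p (n + 1) := by ring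
        rw [h, hp.apply_mul_of_natDegree_lt (by rw [hX]; omega), ho (n + 2) j (by omega),
          ho (n + 1) j (by omega), ho n j (by omega)]
        ring
      · rw [ho (j + 2) j (by omega), ho (j + 1) j (by omega), div_mul_cancel₀ _ (hne _)]
        ring
      · rw [ho (n + 2) (n + 1) (by omega), ho n (n + 1) (by omega), div_mul_cancel₀ _ (hne _)]
        ring
      · rw [ho (n + 1) (n + 2) (by omega), ho n (n + 2) (by omega), div_mul_cancel₀ _ (hne _)]
        ring

/-- Since c ≠ 0, the recurrence pushes a common root down to the nonzero constant p 0. -/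
theorem not_isRoot_and_isRoot_succ (hp : IsOPS u p) (r : ℂ) (n : ℕ) (h0 : (p n).IsRoot r)
    (h1 : (p (n + 1)).IsRoot r) : False := by
  induction n with
  | zero =>
    rw [eq_C_of_natDegree_eq_zero (hp.natDegree_eq 0), IsRoot, eval_C] at h0
    exact hp.coeff_ne_zero 0 h0
  | succ n ih =>
    refine ih ?_ h0
    obtain ⟨a, b, c, hc, h⟩ := hp.exists_recurrence n
    have h2 := congrArg (eval r) h
    simp only [eval_add, eval_mul, eval_C, eval_X] at h2
    rw [h0.eq_zero, h1.eq_zero] at h2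
    have h3 : c * eval r (p n) = 0 := by linear_combination -h2
    exact (mul_eq_zero.1 h3).resolve_left hc

theorem isCoprime_succ (hp : IsOPS u p) (n : ℕ) : IsCoprime (p n) (p (n + 1)) := by
  rw [Polynomial.isCoprime_iff_aeval_ne_zero_of_isAlgClosed ℂ ℂ]
  intro r
  by_contra! h
  exact hp.not_isRoot_and_isRoot_succ r n (by simpa using h.1) (by simpa using h.2)

end IsOPS

/-! ### Identities between iterated operators. -/

namespace LatticeData

variable {K : LatticeData}

theorem S_V : K.S K.V = C K.α * K.V := by
  rw [V, map_sub, map_add, S_C_mul, S_C, S_A, S_X, A]; ring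

theorem D_V : K.D K.V = C K.α ^ 2 - 1 := by
  rw [V, map_sub, map_add, D_C_mul, D_C, D_A, D_X]; ring

theorem V_eq_C : K.V = C (K.α ^ 2 - 1) * X + C (K.β * (K.α + 1)) := by
  rw [V_eq]; simp

theorem D_D_X_mul (f : ℂ[X]) :
    K.D (K.D (X * f)) = 2 * C K.α * K.S (K.D f) + (2 * K.V + X) * K.D (K.D f) := by
  rw [D_X_mul, map_add, D_mul, D_A, S_A, D_S, V]; ring

theorem S_D_X_mul (f : ℂ[X]) :
    K.S (K.D (X * f)) = 2 * C K.α * K.U * K.D (K.D f) + (2 * K.V + X) * K.S (K.D f) + f := by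
  rw [D_X_mul, map_add, S_mul, D_A, S_A, S_S, V]; ring

theorem D_D_V_mul (f : ℂ[X]) :
    K.D (K.D (K.V * f)) = (C K.α ^ 2 - 1) * K.D (K.D (X * f)) +
      C K.β * (C K.α + 1) * K.D (K.D f) := by
  conv_lhs => rw [V_eq_C]
  simp only [add_mul, mul_assoc, map_add, D_C_mul]
  simp only [C_sub, C_add, C_mul, C_pow, C_1]
  ring

theorem D_D_U_mul (f : ℂ[X]) :
    K.D (K.D (K.U * f)) = (C K.α ^ 2 - 1) * K.D (K.D (X * (X * f))) +
      2 * C K.β * (C K.α + 1) * K.D (K.D (X * f)) + C K.υ * K.D (K.D f) := by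
  conv_lhs => rw [U]
  simp only [add_mul, mul_assoc, map_add, D_C_mul, pow_two]
  simp only [C_sub, C_add, C_mul, C_1, map_ofNat]
  ring

theorem D_D_S (p : ℂ[X]) :
    K.D (K.D (K.S p)) =
      2 * C K.α * K.V * K.D (K.D (K.D p)) + (2 * C K.α ^ 2 - 1) * K.S (K.D (K.D p)) := by
  rw [D_S, map_add, D_mul, D_C_mul, D_S, S_V, D_V]; ring

theorem S_D_S (p : ℂ[X]) :
    K.S (K.D (K.S p)) = 2 * C K.α * K.V * K.S (K.D (K.D p)) +
      (2 * C K.α ^ 2 - 1) * K.U * K.D (K.D (K.D p)) + C K.α * K.D p := by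
  rw [D_S, map_add, S_mul, S_C_mul, S_S, S_V, D_V]; ring

theorem D_D_two_mul_V_add_X_mul (f : ℂ[X]) :
    K.D (K.D ((2 * K.V + X) * f)) =
      2 * K.D (K.D (K.V * f)) + K.D (K.D (X * f)) := by
  have h : (2 * K.V + X) * f = K.V * f + K.V * f + X * f := by ring
  rw [h]
  simp only [map_add]
  ring

/-- In this identity and the next, second differences occur only with coefficients constant or
linear in x; these are the terms that the adjoints of πD² and πXD² convert. The next one also
isolates D p, the source of the summand π in the second solution. -/
theorem X_mul_D_D_D (p : ℂ[X]) :
    X * K.D (K.D (K.D p)) - K.D (K.D ((2 * K.V + X) * K.D p)) +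
      2 * C K.α * K.D (K.D (K.S p)) = 0 := by
  rw [D_D_two_mul_V_add_X_mul, D_D_V_mul, D_D_X_mul, D_D_S, V_eq]
  ring

theorem D_eq_sum_D_D (p : ℂ[X]) :
    2 * C K.α * K.D p + X * K.D (K.D (K.V * K.D p)) - K.D (K.D ((2 * K.V + X) * (K.V * K.D p))) +
      2 * C K.α ^ 2 * K.D (K.D (K.U * K.D p)) + C K.α * X * K.D (K.D (K.S p)) -
      C K.α * K.D (K.D (X * K.S p)) = 0 := by
  have h : X * (K.V * K.D p) = K.V * (X * K.D p) := by ring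
  rw [D_D_two_mul_V_add_X_mul, D_D_V_mul (K.V * K.D p), h, D_D_V_mul (X * K.D p), D_D_V_mul (K.D p),
    D_D_U_mul, D_D_X_mul (X * K.D p), D_D_X_mul (K.S p), S_D_X_mul, D_D_X_mul (K.D p), D_D_S,
    S_D_S, V_eq, U_eq]
  ring

end LatticeData

/-! ### From orthogonality of the second differences to a Pearson solution. -/

namespace LatticeData

variable {K : LatticeData} {u : ℂ[X] →ₗ[ℂ] ℂ} {p : ℕ → ℂ[X]}

theorem natDegree_D_D_coeff {f : ℂ[X]} {n : ℕ} (hf : f.natDegree ≤ n + 2) :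
    (K.D (K.D f)).natDegree ≤ n ∧
      (K.D (K.D f)).coeff n = K.γ (n + 1) * (K.γ (n + 2) * f.coeff (n + 2)) := by
  obtain ⟨h1, h2⟩ := K.natDegree_D_coeff hf
  obtain ⟨h3, h4⟩ := K.natDegree_D_coeff h1
  exact ⟨h3, by rw [h4, h2]⟩

theorem D_D_of_natDegree_le_one {f : ℂ[X]} (hf : f.natDegree ≤ 1) : K.D (K.D f) = 0 :=
  K.D_of_natDegree_eq_zero (K.natDegree_D_coeff hf).1

theorem _root_.IsOPS.D_D_natDegree_coeff (hp : IsOPS u p) (hK : K.Nondegenerate) (n : ℕ) :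
    (K.D (K.D (p (n + 2)))).natDegree ≤ n ∧ (K.D (K.D (p (n + 2)))).coeff n ≠ 0 := by
  obtain ⟨h1, h2⟩ := natDegree_D_D_coeff (K := K) (hp.natDegree_eq (n + 2)).le
  refine ⟨h1, ?_⟩
  rw [h2]
  exact mul_ne_zero (hK n) (mul_ne_zero (hK (n + 1)) (hp.coeff_ne_zero _))

/-- D²p_2 is a nonzero constant and D²p_3 is linear. Orthogonality to them makes u(π D²p_n) vanish
for n > 2 and u(π X D²p_n) for n > 3, so only p_2 and p_3 enter the representing polynomials. -/
theorem exists_second_adjoint (hK : K.Nondegenerate) (hp : IsOPS u p) {π : ℂ[X]}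
    (ho : ∀ m n, 2 ≤ m → 2 ≤ n → m ≠ n → u (K.D (K.D (p m)) * K.D (K.D (p n)) * π) = 0)
    (hn : ∀ n, 2 ≤ n → u (K.D (K.D (p n)) * K.D (K.D (p n)) * π) ≠ 0) :
    ∃ c c₂ c₃ : ℂ, c ≠ 0 ∧ c₃ ≠ 0 ∧ (∀ f, u (π * K.D (K.D f)) = u (C c * p 2 * f)) ∧
      ∀ f, u (π * (X * K.D (K.D f))) = u ((C c₂ * p 2 + C c₃ * p 3) * f) := by
  obtain ⟨d2, k2⟩ := hp.D_D_natDegree_coeff hK 0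
  obtain ⟨d3, k3⟩ := hp.D_D_natDegree_coeff hK 1
  obtain ⟨a, b, k, ha, hk, e2, e3⟩ : ∃ a b k : ℂ, a ≠ 0 ∧ k ≠ 0 ∧ K.D (K.D (p 2)) = C k ∧
      K.D (K.D (p 3)) = C a * X + C b :=
    ⟨_, _, _, k3, k2, eq_C_of_natDegree_le_zero d2, eq_X_add_C_of_natDegree_le_one d3⟩
  have q0 : K.D (K.D (p 0)) = 0 := D_D_of_natDegree_le_one (by rw [hp.natDegree_eq]; omega)
  have q1 : K.D (K.D (p 1)) = 0 := D_D_of_natDegree_le_one (by rw [hp.natDegree_eq])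
  have s2 : ∀ f, u (K.D (K.D (p 2)) * f * π) = k * u (π * f) := fun f => by
    rw [e2, ← LinearMap.apply_C_mul]; congr 1; ring
  have s3 : ∀ f, u (K.D (K.D (p 3)) * f * π) = a * u (π * (X * f)) + b * u (π * f) := fun f => by
    rw [e3, ← LinearMap.apply_C_mul, ← LinearMap.apply_C_mul, ← map_add]; congr 1; ring
  have z1 : ∀ n, 2 < n → u (π * K.D (K.D (p n))) = 0 := fun n h => by
    have := ho 2 n le_rfl h.le h.ne
    rw [s2] at this
    exact (mul_eq_zero.1 this).resolve_left hk
  have z2 : ∀ n, 3 < n → u (π * (X * K.D (K.D (p n)))) = 0 := fun n h => by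
    have := ho 3 n (by omega) (by omega) h.ne
    rw [s3, z1 n (by omega), mul_zero, add_zero] at this
    exact (mul_eq_zero.1 this).resolve_left ha
  have n2 : u (π * K.D (K.D (p 2))) ≠ 0 := fun h => by
    have := hn 2 le_rfl
    rw [s2, h, mul_zero] at this
    exact this rfl
  have n3 : u (π * (X * K.D (K.D (p 3)))) ≠ 0 := fun h => by
    have := hn 3 (by omega)
    rw [s3, z1 3 (by omega), h, mul_zero, mul_zero, add_zero] at this
    exact this rfl
  have hne := hp.apply_mul_ne_zero
  have hz := hp.apply_mul_eq_zero
  refine ⟨u (π * K.D (K.D (p 2))) / u (p 2 * p 2), u (π * (X * K.D (K.D (p 2)))) / u (p 2 * p 2),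
    u (π * (X * K.D (K.D (p 3)))) / u (p 3 * p 3), div_ne_zero n2 (hne 2), div_ne_zero n3 (hne 3),
    hp.induction ?_ ?_ ?_, hp.induction ?_ ?_ ?_⟩
  · intro f g hf hg
    simp only [mul_add, map_add, hf, hg]
  · intro c f hf
    simp only [D_C_mul, mul_left_comm _ (C c), LinearMap.apply_C_mul, hf]
  · intro j
    rw [mul_assoc, LinearMap.apply_C_mul]
    obtain rfl | rfl | rfl | hj : j = 0 ∨ j = 1 ∨ j = 2 ∨ 2 < j := by omega
    · rw [q0, hz 2 0 (by omega)]; simp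
    · rw [q1, hz 2 1 (by omega)]; simp
    · rw [div_mul_cancel₀ _ (hne 2)]
    · rw [z1 j hj, hz 2 j (by omega)]; simp
  · intro f g hf hg
    simp only [mul_add, map_add, hf, hg]
  · intro c f hf
    simp only [D_C_mul, mul_left_comm _ (C c), LinearMap.apply_C_mul, hf]
  · intro j
    rw [add_mul, map_add, mul_assoc, LinearMap.apply_C_mul, mul_assoc, LinearMap.apply_C_mul]
    obtain rfl | rfl | rfl | rfl | hj : j = 0 ∨ j = 1 ∨ j = 2 ∨ j = 3 ∨ 3 < j := by omega
    · rw [q0, hz 2 0 (by omega), hz 3 0 (by omega)]; simp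
    · rw [q1, hz 2 1 (by omega), hz 3 1 (by omega)]; simp
    · rw [div_mul_cancel₀ _ (hne 2), hz 3 2 (by omega)]; simp
    · rw [div_mul_cancel₀ _ (hne 3), hz 2 3 (by omega)]; simp
    · rw [z2 j hj, hz 2 j (by omega), hz 3 j (by omega)]; simp

/-- Adjoints of `π D²` and `π X D²` yield two solutions of the Pearson equation. -/
theorem pearson_of_second_adjoint {π ρ τ ζ : ℂ[X]}
    (hα : K.α ≠ 0) (hρ : ∀ f, u (π * K.D (K.D f)) = u (ρ * f))
    (hτ : ∀ f, u (π * (X * K.D (K.D f))) = u (τ * f))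
    (hζ : 2 * C K.α * ζ = τ - (2 * K.V + X) * ρ) :
    Pearson u (⟨ζ, ρ⟩ : K.Pair) ∧
      Pearson u (K.ι π + (K.ev K.A - K.ι X) * ⟨ζ, ρ⟩ : K.Pair) := by
  have h2α : 2 * K.α ≠ 0 := mul_ne_zero two_ne_zero hα
  have e2 : (2 : ℂ[X]) * C K.α = C (2 * K.α) := by rw [C_mul, map_ofNat]
  have cancel : ∀ f : ℂ[X], u (2 * C K.α * f) = 0 → u f = 0 := fun f hf => by
    rw [e2, LinearMap.apply_C_mul] at hf
    exact (mul_eq_zero.1 hf).resolve_left h2α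
  have hC : ∀ (c : ℂ) (f g : ℂ[X]), u f = u g → u (C c * f) = u (C c * g) := fun c f g h => by
    rw [LinearMap.apply_C_mul, LinearMap.apply_C_mul, h]
  constructor
  · rw [pearson_iff]
    intro q
    apply cancel
    have h1 := hτ (K.D q)
    have h2 := hρ ((2 * K.V + X) * K.D q)
    have h3 := hC (2 * K.α) _ _ (hρ (K.S q))
    have h := congrArg (fun f => u (π * f)) (K.X_mul_D_D_D q)
    simp only [mul_zero, map_zero] at h
    have e : 2 * C K.α * (ζ * K.D q + ρ * K.S q) =
        τ * K.D q - ρ * ((2 * K.V + X) * K.D q) + C (2 * K.α) * (ρ * K.S q) := by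
      rw [← e2]; linear_combination K.D q * hζ
    have e' : π * (X * K.D (K.D (K.D q)) - K.D (K.D ((2 * K.V + X) * K.D q)) +
        2 * C K.α * K.D (K.D (K.S q))) = π * (X * K.D (K.D (K.D q))) -
        π * K.D (K.D ((2 * K.V + X) * K.D q)) + C (2 * K.α) * (π * K.D (K.D (K.S q))) := by
      rw [← e2]; ring
    simp only
    rw [e, map_add, map_sub, ← h1, ← h2, ← h3, ← map_sub, ← map_add, ← e', h]
  · rw [pearson_iff]
    intro q
    apply cancel
    have h1 := hτ (K.V * K.D q)
    have h2 := hρ ((2 * K.V + X) * (K.V * K.D q))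
    have h3 := hC (2 * K.α ^ 2) _ _ (hρ (K.U * K.D q))
    have h4 := hC K.α _ _ (hτ (K.S q))
    have h5 := hC K.α _ _ (hρ (X * K.S q))
    have h := congrArg (fun f => u (π * f)) (K.D_eq_sum_D_D q)
    simp only [mul_zero, map_zero] at h
    have e3 : C (2 * K.α ^ 2) = 2 * C K.α ^ 2 := by rw [C_mul, C_pow, map_ofNat]
    have e : 2 * C K.α * ((π + K.V * ζ + K.U * C K.α * ρ) * K.D q + (K.V * ρ + C K.α * ζ) * K.S q) =
        2 * C K.α * (π * K.D q) + τ * (K.V * K.D q) - ρ * ((2 * K.V + X) * (K.V * K.D q)) +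
        C (2 * K.α ^ 2) * (ρ * (K.U * K.D q)) + C K.α * (τ * K.S q) -
        C K.α * (ρ * (X * K.S q)) := by
      rw [e3]; linear_combination (K.V * K.D q + C K.α * K.S q) * hζ
    have e' : π * (2 * C K.α * K.D q + X * K.D (K.D (K.V * K.D q)) -
        K.D (K.D ((2 * K.V + X) * (K.V * K.D q))) +
        2 * C K.α ^ 2 * K.D (K.D (K.U * K.D q)) + C K.α * X * K.D (K.D (K.S q)) -
        C K.α * K.D (K.D (X * K.S q))) = 2 * C K.α * (π * K.D q) +
        π * (X * K.D (K.D (K.V * K.D q))) - π * K.D (K.D ((2 * K.V + X) * (K.V * K.D q))) +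
        C (2 * K.α ^ 2) * (π * K.D (K.D (K.U * K.D q))) +
        C K.α * (π * (X * K.D (K.D (K.S q)))) - C K.α * (π * K.D (K.D (X * K.S q))) := by
      rw [e3]; ring
    have er : (K.ι π + (K.ev K.A - K.ι X) * ⟨ζ, ρ⟩ : K.Pair) =
        ⟨π + K.V * ζ + K.U * C K.α * ρ, K.V * ρ + C K.α * ζ⟩ := by
      rw [ev_A_sub, QuadraticAlgebra.algebraMap_eq]
      ext1
      · simp; ring
      · simp
    rw [er]
    simp only
    rw [e, map_sub, map_add, map_add, map_sub, map_add, ← h1, ← h2, ← h3, ← h4, ← h5, ← map_add,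
      ← map_sub, ← map_add, ← map_add, ← map_sub, ← e', h]

theorem natDegree_V : K.V.natDegree ≤ 1 := by
  rw [V_eq_C]; exact natDegree_linear_le

/-- Orthogonality of the second divided differences yields a solution of the Pearson equation of
degree at most two and one. -/
theorem exists_pearson_degreeLE_one (hK : K.Nondegenerate) (hp : IsOPS u p) {π : ℂ[X]}
    (hπ : π.natDegree ≤ 4)
    (ho : ∀ m n, 2 ≤ m → 2 ≤ n → m ≠ n → u (K.D (K.D (p m)) * K.D (K.D (p n)) * π) = 0)
    (hn : ∀ n, 2 ≤ n → u (K.D (K.D (p n)) * K.D (K.D (p n)) * π) ≠ 0) :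
    ∃ F : K.Pair, F ≠ 0 ∧ DegreeLE F 1 ∧ Pearson u F := by
  obtain ⟨c, c₂, c₃, hc, hc₃, hρ, hτ⟩ := exists_second_adjoint hK hp ho hn
  have hα := hK.α_ne_zero
  have hπ0 : π ≠ 0 := by
    rintro rfl
    exact hn 2 le_rfl (by simp)
  have hc' : IsUnit (C c) := isUnit_C.2 hc.isUnit
  have dρ : (C c * p 2).natDegree = 2 := by
    rw [natDegree_C_mul hc, hp.natDegree_eq]
  have dτ : (C c₂ * p 2 + C c₃ * p 3).natDegree ≤ 3 := by
    refine natDegree_add_le_of_degree_le ?_ ?_ <;>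
      refine (natDegree_C_mul_le _ _).trans ?_ <;> rw [hp.natDegree_eq]
    omega
  have hcop : IsCoprime (C c * p 2) (C c₂ * p 2 + C c₃ * p 3) := by
    have h1 : IsCoprime (C c * p 2) (C c₃ * p 3) :=
      (isCoprime_mul_unit_left_left hc' _ _).2
        ((isCoprime_mul_unit_left_right (isUnit_C.2 hc₃.isUnit) _ _).2 (hp.isCoprime_succ 2))
    have e : C c₂ * p 2 + C c₃ * p 3 = C c₃ * p 3 + C c * p 2 * C (c₂ / c) := by
      have : C c₂ = C c * C (c₂ / c) := by rw [← C_mul, mul_div_cancel₀ _ hc]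
      rw [this]; ring
    rw [e]
    exact h1.add_mul_left_right _
  generalize C c * p 2 = ρ at *
  generalize C c₂ * p 2 + C c₃ * p 3 = τ at *
  obtain ⟨ζ, hζ⟩ : ∃ ζ, ζ = C (2 * K.α)⁻¹ * (τ - (2 * K.V + X) * ρ) := ⟨_, rfl⟩
  have h2α : 2 * K.α ≠ 0 := mul_ne_zero two_ne_zero hα
  have hζ' : 2 * C K.α * ζ = τ - (2 * K.V + X) * ρ := by
    have e2 : (2 : ℂ[X]) * C K.α = C (2 * K.α) := by rw [C_mul, map_ofNat]
    rw [hζ, e2, ← mul_assoc, ← C_mul, mul_inv_cancel₀ h2α, C_1, one_mul]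
  obtain ⟨PZ, PY⟩ := pearson_of_second_adjoint hα hρ hτ hζ'
  have dV := natDegree_V (K := K)
  have dζ : ζ.natDegree ≤ 3 := by
    rw [hζ]
    refine (natDegree_C_mul_le _ _).trans ((natDegree_sub_le _ _).trans (max_le dτ ?_))
    refine natDegree_mul_le.trans ?_
    have : (2 * K.V + X).natDegree ≤ 1 := by
      refine natDegree_add_le_of_degree_le (natDegree_mul_le.trans ?_) natDegree_X_le
      rw [natDegree_ofNat]; omega
    omega
  have hcop' : IsCoprime ρ ζ := by
    have h1 : IsCoprime ρ (2 * C K.α * ζ) := by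
      rw [hζ', sub_eq_add_neg, mul_comm, ← mul_neg]
      exact hcop.add_mul_left_right _
    exact h1.of_mul_right_right
  have hZ0 : (⟨ζ, ρ⟩ : K.Pair) ≠ 0 := fun h => by
    have : ρ = 0 := congrArg QuadraticAlgebra.im h
    rw [this] at dρ; simp at dρ
  have dZ : DegreeLE (⟨ζ, ρ⟩ : K.Pair) 2 := ⟨dζ, dρ.le⟩
  -- The excess is real: ρ is a multiple of p_2, of degree exactly 2.
  have ndZ : ¬ DegreeLE (⟨ζ, ρ⟩ : K.Pair) 1 := fun h => by
    have := h.2; simp only at this; omega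
  obtain ⟨H, k, h, PH, hZ, hY⟩ := PZ.exists_generator hp.regular PY hZ0
  have hH0 : H ≠ 0 := by
    rintro rfl
    rw [mul_zero] at hZ
    exact hZ0 hZ
  -- If k is nonconstant, H is Z with a nonconstant polynomial in y divided out, and so has the
  -- required degree.
  rcases Nat.eq_zero_or_pos k.natDegree with hk | hk
  swap
  · rw [hZ] at dZ
    exact ⟨H, hH0, dZ.of_ev_mul_of_natDegree_pos hk, PH⟩
  exfalso
  rw [eq_C_of_natDegree_eq_zero hk] at hZ
  have hk0 : k.coeff 0 ≠ 0 := fun h0 => by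
    rw [h0, C_0, map_zero, zero_mul] at hZ
    exact hZ0 hZ
  generalize k.coeff 0 = k₀ at hZ hk0
  have hY' : (K.ι π + (K.ev K.A - K.ι X) * ⟨ζ, ρ⟩ : K.Pair) = K.ev (C k₀⁻¹ * h) * ⟨ζ, ρ⟩ := by
    have : K.ev (C k₀⁻¹ * h) * (⟨ζ, ρ⟩ : K.Pair) = K.ev (C k₀⁻¹ * C k₀) * (K.ev h * H) := by
      rw [hZ]; simp only [map_mul]; ring
    rw [this, ← C_mul, inv_mul_cancel₀ hk0, C_1, map_one, one_mul, hY]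
  generalize C k₀⁻¹ * h = g at hY'
  have dY : DegreeLE (K.ev g * ⟨ζ, ρ⟩ : K.Pair) 3 := by
    rw [← hY', ev_A_sub, QuadraticAlgebra.algebraMap_eq]
    constructor
    · simp only [QuadraticAlgebra.mk_mul_mk, QuadraticAlgebra.re_add]
      refine natDegree_add_le_of_degree_le hπ (natDegree_add_le_of_degree_le
        (natDegree_mul_le.trans (by omega)) ?_)
      refine natDegree_mul_le.trans ?_
      have := natDegree_mul_C_le K.U K.α
      have := K.natDegree_U
      omega
    · simp only [QuadraticAlgebra.mk_mul_mk, QuadraticAlgebra.im_add, zero_mul, add_zero]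
      refine natDegree_add_le_of_degree_le (by simp) (natDegree_add_le_of_degree_le
        (natDegree_mul_le.trans (by omega)) ?_)
      exact (natDegree_C_mul_le _ _).trans dζ
  -- With deg g ≥ 2, the bound on Y = g(y)Z would bring Z down to the degree excluded by `ndZ`.
  have dg : g.natDegree ≤ 1 := by
    by_contra! hg
    obtain ⟨n, hn'⟩ : ∃ n, g.natDegree = n + 1 := ⟨g.natDegree - 1, by omega⟩
    obtain ⟨r, q, rfl, hq⟩ := Polynomial.exists_eq_X_sub_C_mul hn'
    rw [map_mul, mul_assoc] at dY
    exact ndZ (dY.of_ev_X_sub_C_mul.of_ev_mul_of_natDegree_pos (by omega))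
  have hE : K.ι π = (K.ev g - (K.ev K.A - K.ι X)) * (⟨ζ, ρ⟩ : K.Pair) := by
    rw [sub_mul, ← hY']; ring
  rw [ev_A_sub, ev_eq, QuadraticAlgebra.mk_sub_mk, QuadraticAlgebra.mk_mul_mk,
    QuadraticAlgebra.algebraMap_eq] at hE
  have hre := congrArg QuadraticAlgebra.re hE
  have him := congrArg QuadraticAlgebra.im hE
  simp only [zero_mul, add_zero] at hre him
  have dE : (K.D g - C K.α).natDegree ≤ 0 :=
    (natDegree_sub_le _ _).trans (max_le (K.natDegree_D_coeff dg).1 (by simp))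
  -- The ω-component gives (S g - V)ρ + (D g - α)ζ = 0. As ρ is coprime to ζ and has degree 2, the
  -- constant D g - α vanishes; then S g = V, and the other component gives π = 0.
  have hdvd : ρ ∣ K.D g - C K.α := by
    refine hcop'.dvd_of_dvd_mul_right ?_
    exact ⟨-(K.S g - K.V), by linear_combination -him⟩
  have hE1 : K.D g - C K.α = 0 := eq_zero_of_dvd_of_natDegree_lt hdvd (by omega)
  rw [hE1, zero_mul, add_zero] at him
  have hE0 : K.S g - K.V = 0 := by
    refine (mul_eq_zero.1 him.symm).resolve_right ?_
    rintro rfl; simp at dρ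
  rw [hE0, hE1] at hre
  exact hπ0 (by rw [hre]; ring)

end LatticeData

/-! ### The operator φD² + ψSD and its symmetry. -/

namespace LatticeData

variable {K : LatticeData} {u : ℂ[X] →ₗ[ℂ] ℂ} {p : ℕ → ℂ[X]}

/-- The second order operator `φ D² + ψ S D` attached to the pair `(φ, ψ)`. -/
noncomputable def bochner (F : K.Pair) : ℂ[X] →ₗ[ℂ] ℂ[X] where
  toFun f := F.re * K.D (K.D f) + F.im * K.S (K.D f)
  map_add' f g := by simp only [map_add]; ring
  map_smul' c f := by
    simp only [map_smul, RingHom.id_apply, smul_add, mul_smul_comm]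

theorem bochner_apply (F : K.Pair) (f : ℂ[X]) :
    bochner F f = F.re * K.D (K.D f) + F.im * K.S (K.D f) := rfl

theorem bochner_eq_im (F : K.Pair) (f : ℂ[X]) : bochner F f = (F * K.ev (K.D f)).im := by
  rw [QuadraticAlgebra.im_mul, ev_re, ev_im, zero_mul, zero_mul, add_zero, bochner_apply]

/-- Writing g(x) over the polynomials in y by `ι_eq` isolates a term symmetric in f and g; the other
term is of Pearson form. -/
theorem bochner_mul_eq (F : K.Pair) (f g : ℂ[X]) :
    bochner F f * g = (F * K.ev (K.D f * (K.S g - K.A * K.D g))).im +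
      (F * K.ev (K.D f) * K.ev (K.D g) * K.ι X).im := by
  have h : bochner F f * g = (F * K.ev (K.D f) * K.ι g).im := by
    rw [bochner_eq_im, QuadraticAlgebra.algebraMap_eq, QuadraticAlgebra.im_mul _ ⟨g, 0⟩]
    simp
  rw [h, K.ι_eq g, ← QuadraticAlgebra.im_add]
  congr 1
  simp only [map_mul, map_sub]
  ring

/-- The operator `φ D² + ψ S D` fails to be symmetric by a Pearson functional. -/
theorem apply_bochner_sub (F : K.Pair) (f g : ℂ[X]) :
    u (bochner F f * g) - u (f * bochner F g) =
      u (F * K.ev (K.D f * K.S g - K.D g * K.S f)).im := by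
  have h1 : F * K.ev (K.D f) * K.ev (K.D g) * K.ι X = F * K.ev (K.D g) * K.ev (K.D f) * K.ι X := by
    ring
  have h2 : ∀ a b, (F * K.ev a).im - (F * K.ev b).im = (F * K.ev (a - b)).im := fun a b => by
    rw [map_sub, mul_sub, QuadraticAlgebra.im_sub]
  have h3 : K.D f * K.S g - K.D g * K.S f =
      K.D f * (K.S g - K.A * K.D g) - K.D g * (K.S f - K.A * K.D f) := by ring
  rw [mul_comm f, ← map_sub, bochner_mul_eq, bochner_mul_eq, h1, add_sub_add_right_eq_sub, h2, h3]

theorem Pearson.apply_bochner {F : K.Pair} (hF : Pearson u F) (f g : ℂ[X]) :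
    u (bochner F f * g) = u (f * bochner F g) := by
  rw [← sub_eq_zero, apply_bochner_sub]
  exact hF _

theorem DegreeLE.natDegree_mul_add_coeff {F : K.Pair} (hF : DegreeLE F 1) {g : ℂ[X]} {n : ℕ}
    (hg : g.natDegree ≤ n) :
    (F.re * K.D g + F.im * K.S g).natDegree ≤ n + 1 ∧
      (F.re * K.D g + F.im * K.S g).coeff (n + 1) =
        (F.re.coeff 2 * K.γ n + F.im.coeff 1 * K.σ n) * g.coeff n := by
  obtain ⟨s1, s2⟩ := K.natDegree_S_coeff hg
  obtain ⟨f1, f2⟩ := hF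
  have hS := coeff_mul_add_eq_of_natDegree_le f2 s1
  rw [add_comm 1 n, s2] at hS
  have dS : (F.im * K.S g).natDegree ≤ n + 1 := natDegree_mul_le.trans (by omega)
  cases n with
  | zero =>
    rw [K.D_of_natDegree_eq_zero hg, mul_zero, zero_add, γ_zero, hS]
    exact ⟨dS, by ring⟩
  | succ m =>
    obtain ⟨d1, d2⟩ := K.natDegree_D_coeff hg
    have hD := coeff_mul_add_eq_of_natDegree_le f1 d1
    rw [show 1 + 1 + m = m + 1 + 1 by ring, d2] at hD
    refine ⟨natDegree_add_le_of_degree_le (natDegree_mul_le.trans (by omega)) dS, ?_⟩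
    rw [coeff_add, hS, hD]
    ring

theorem DegreeLE.natDegree_bochner_coeff {F : K.Pair} (hF : DegreeLE F 1) {f : ℂ[X]} {n : ℕ}
    (hf : f.natDegree ≤ n + 1) :
    (bochner F f).natDegree ≤ n + 1 ∧ (bochner F f).coeff (n + 1) =
      (F.re.coeff 2 * K.γ n + F.im.coeff 1 * K.σ n) * (K.γ (n + 1) * f.coeff (n + 1)) := by
  obtain ⟨h1, h2⟩ := K.natDegree_D_coeff hf
  rw [← h2]
  exact hF.natDegree_mul_add_coeff h1

theorem DegreeLE.natDegree_bochner_le {F : K.Pair} (hF : DegreeLE F 1) {f : ℂ[X]} {n : ℕ}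
    (hf : f.natDegree ≤ n) : (bochner F f).natDegree ≤ n := by
  cases n with
  | zero =>
    rw [bochner_apply, K.D_of_natDegree_eq_zero hf]
    simp
  | succ n => exact (hF.natDegree_bochner_coeff hf).1

theorem _root_.IsOPS.exists_bochner_eq (hp : IsOPS u p) {F : K.Pair} (hF : Pearson u F)
    (hd : DegreeLE F 1) (n : ℕ) : ∃ c : ℂ, bochner F (p n) = C c * p n := by
  refine ⟨_, hp.eq_C_mul (hd.natDegree_bochner_le (hp.natDegree_eq n).le) fun j hj => ?_⟩
  rw [hF.apply_bochner, mul_comm]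
  have h1 := hd.natDegree_bochner_le (hp.natDegree_eq j).le
  exact hp.apply_mul_of_natDegree_lt (by omega)

/-- Testing with p = 1 gives u(ψ) = 0, so a constant ψ is zero. Then φ is orthogonal to the range of
`D`, which is everything, so F = 0. -/
theorem Pearson.natDegree_im (hK : K.Nondegenerate) (hp : IsOPS u p) {F : K.Pair}
    (hF : Pearson u F) (hd : DegreeLE F 1) (h0 : F ≠ 0) : F.im.natDegree = 1 := by
  have hle : F.im.natDegree ≤ 1 := hd.2
  by_contra hne
  have h1 : F.im.natDegree = 0 := by omega
  have him : F.im = 0 := by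
    refine hp.eq_zero_of_natDegree_le h1.le fun j hj => ?_
    obtain rfl : j = 0 := by omega
    have h2 := hF 1
    rw [map_one, mul_one] at h2
    rw [eq_C_of_natDegree_eq_zero (hp.natDegree_eq 0), mul_comm, LinearMap.apply_C_mul, h2,
      mul_zero]
  have hre : F.re = 0 := hp.regular _ fun g => by
    obtain ⟨q, rfl⟩ := hK.D_surjective g
    have := (pearson_iff F).1 hF q
    rwa [him, zero_mul, add_zero] at this
  apply h0
  ext1
  · exact hre
  · exact him

/-- If `φ D² + ψ S D` maps almost all members of an orthogonal sequence to multiples of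
themselves, then `(φ, ψ)` satisfies the Pearson equation. -/
theorem pearson_of_bochner_eq (hK : K.Nondegenerate) (hp : IsOPS u p) {F : K.Pair}
    (hd : DegreeLE F 1) (N : ℕ) (h : ∀ n, N ≤ n → ∃ c : ℂ, bochner F (p n) = C c * p n) :
    Pearson u F := by
  obtain ⟨Ψ, hΨ⟩ : ∃ Ψ : ℂ[X] →ₗ[ℂ] ℂ, ∀ q, Ψ q = u (F * K.ev q).im :=
    ⟨{ toFun := fun q => u (F * K.ev q).im
       map_add' := fun q r => by rw [map_add, mul_add, QuadraticAlgebra.im_add, map_add]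
       map_smul' := fun c q => by
        rw [map_smul, mul_smul_comm, QuadraticAlgebra.im_smul, map_smul]; rfl }, fun q => rfl⟩
  -- Let x₊, x₋ be the two neighbours of x. The expression W(f, g) = D f S g - D g S f equals
  -- (f(x₊)g(x₋) - f(x₋)g(x₊))/(x₊ - x₋).
  let M : Submodule ℂ ℂ[X] :=
    { carrier := {f | ∀ g, Ψ (K.D f * K.S g - K.D g * K.S f) = 0}
      add_mem' := fun {a b} ha hb g => by
        have e : K.D (a + b) * K.S g - K.D g * K.S (a + b) =
          (K.D a * K.S g - K.D g * K.S a) + (K.D b * K.S g - K.D g * K.S b) := by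
            rw [map_add, map_add]; ring
        rw [e, map_add, ha, hb, add_zero]
      zero_mem' := fun g => by simp
      smul_mem' := fun c a ha g => by
        have e : K.D (c • a) * K.S g - K.D g * K.S (c • a) =
          c • (K.D a * K.S g - K.D g * K.S a) := by
            rw [map_smul, map_smul, smul_mul_assoc, mul_smul_comm, smul_sub]
        rw [e, map_smul, ha, smul_zero] }
  have hM : ∀ n, N ≤ n → p n ∈ M := by
    intro n hn g
    rw [hΨ, ← apply_bochner_sub, sub_eq_zero]
    obtain ⟨c, hc⟩ := h n hn
    revert g
    refine hp.induction ?_ ?_ ?_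
    · intro f g hf hg
      rw [map_add, mul_add, mul_add, map_add, map_add, hf, hg]
    · intro a f hf
      rw [C_mul', map_smul, mul_smul_comm, mul_smul_comm, map_smul, map_smul, hf]
    · intro j
      rcases le_or_gt N j with hj | hj
      · obtain ⟨d, hd'⟩ := h j hj
        rw [hc, hd', mul_left_comm, mul_assoc, LinearMap.apply_C_mul, LinearMap.apply_C_mul]
        rcases eq_or_ne n j with rfl | hne
        · have h1 : C c * p n = C d * p n := by rw [← hc, ← hd']
          have h2 := C_injective (mul_right_cancel₀ (hp.ne_zero n) h1)
          rw [h2]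
        · rw [hp.apply_mul_eq_zero n j hne, mul_zero, mul_zero]
      -- For j < N no eigenvalue is available, but the image of p_j has degree at most j < n, so
      -- both sides vanish.
      · have h1 := hd.natDegree_bochner_le (hp.natDegree_eq j).le
        have h2 : u (bochner F (p j) * p n) = 0 := hp.apply_mul_of_natDegree_lt (by omega)
        rw [hc, mul_comm (p n), h2, mul_assoc, LinearMap.apply_C_mul,
          hp.apply_mul_eq_zero n j (by omega), mul_zero]
  -- The points x₊ and x₋ satisfy a symmetric quadratic relation expressing x₊² + x₋² through x₊x₋,
  -- x₊ + x₋ and 1. Multiplied by W(f, g), it expresses W(X²f, g) by values of W with f or Xf in the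
  -- first slot.
  have hX2 : ∀ f, f ∈ M → X * f ∈ M → X * (X * f) ∈ M := by
    intro f h1 h2 g
    have e : K.D (X * (X * f)) * K.S g - K.D g * K.S (X * (X * f)) =
        C (2 * (2 * K.α ^ 2 - 1)) * (K.D (X * f) * K.S (X * g) - K.D (X * g) * K.S (X * f)) -
        (K.D f * K.S (X * (X * g)) - K.D (X * (X * g)) * K.S f) +
        C (4 * K.β * (K.α + 1)) * (K.D (X * f) * K.S g - K.D g * K.S (X * f)) +
        C (4 * K.β * (K.α + 1)) * (K.D f * K.S (X * g) - K.D (X * g) * K.S f) +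
        C (4 * K.α ^ 2 * K.υ - 4 * K.β ^ 2 * (K.α + 1) ^ 2) * (K.D f * K.S g - K.D g * K.S f) := by
      simp only [D_X_mul, S_X_mul, C_sub, C_add, C_mul, C_pow, C_1, map_ofNat]
      rw [A, U_eq]
      ring
    rw [e, map_add, map_add, map_add, map_sub]
    simp only [LinearMap.apply_C_mul]
    rw [h1, h1, h1, h2, h2]
    ring
  -- The recurrence is run downwards: X p_{n+2} and X p_{n+3} lie in M, hence so does X² p_{n+2},
  -- hence X p_{n+1} because c₁ ≠ 0, hence p_n because c₀ ≠ 0.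
  have hdown : ∀ k n, N ≤ n + k → p n ∈ M := by
    intro k
    induction k with
    | zero => exact fun n hn => hM n hn
    | succ k ih =>
      intro n hn
      have i1 := ih (n + 1) (by omega)
      have i2 := ih (n + 2) (by omega)
      have i3 := ih (n + 3) (by omega)
      have i4 := ih (n + 4) (by omega)
      have memC : ∀ c f, f ∈ M → C c * f ∈ M := fun c f hf => by
        rw [C_mul']; exact M.smul_mem c hf
      have memC' : ∀ c f, c ≠ 0 → C c * f ∈ M → f ∈ M := fun c f hc hf => by
        rw [C_mul'] at hf; exact (M.smul_mem_iff hc).1 hf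
      obtain ⟨a₀, b₀, c₀, hc₀, r₀⟩ := hp.exists_recurrence n
      obtain ⟨a₁, b₁, c₁, hc₁, r₁⟩ := hp.exists_recurrence (n + 1)
      obtain ⟨a₂, b₂, c₂, hc₂, r₂⟩ := hp.exists_recurrence (n + 2)
      have j2 : X * p (n + 2) ∈ M := by
        rw [r₁]; exact add_mem (add_mem (memC _ _ i3) (memC _ _ i2)) (memC _ _ i1)
      have j3 : X * p (n + 3) ∈ M := by
        rw [r₂]; exact add_mem (add_mem (memC _ _ i4) (memC _ _ i3)) (memC _ _ i2)
      have j1 : X * p (n + 1) ∈ M := by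
        apply memC' c₁ _ hc₁
        have e : C c₁ * (X * p (n + 1)) = X * (X * p (n + 2)) - C a₁ * (X * p (n + 3)) -
            C b₁ * (X * p (n + 2)) := by
          linear_combination (-X) * r₁
        rw [e]
        exact sub_mem (sub_mem (hX2 _ i2 j2) (memC _ _ j3)) (memC _ _ j2)
      apply memC' c₀ _ hc₀
      have e : C c₀ * p n = X * p (n + 1) - C a₀ * p (n + 2) - C b₀ * p (n + 1) := by
        rw [r₀]; ring
      rw [e]
      exact sub_mem (sub_mem j1 (memC _ _ i2)) (memC _ _ i1)
  have hall : ∀ f, f ∈ M := by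
    refine hp.induction (fun f g hf hg => add_mem hf hg) (fun c f hf => ?_)
      (fun j => hdown N j (by omega))
    rw [C_mul']; exact M.smul_mem c hf
  intro q
  obtain ⟨f, rfl⟩ := hK.D_surjective q
  -- W(f, 1) = D f, and `D` is surjective.
  have h1 := hall f 1
  rw [S_one, D_one, zero_mul, sub_zero, mul_one, hΨ] at h1
  exact h1

end LatticeData

/-! ### From a Pearson solution to orthogonality of the second differences. -/

namespace LatticeData

variable {K : LatticeData} {u : ℂ[X] →ₗ[ℂ] ℂ} {p : ℕ → ℂ[X]}

/-- If the leading factor vanishes, g ↦ φ D g + ψ S g preserves the polynomials of degree at most n.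
Its range lies in the kernel of u and so misses p 0; in finite dimension it then has a kernel. -/
theorem exists_mul_D_add_mul_S_eq_zero (hp : IsOPS u p) {F : K.Pair} (hF : Pearson u F)
    (hd : DegreeLE F 1) {n : ℕ} (h : F.re.coeff 2 * K.γ n + F.im.coeff 1 * K.σ n = 0) :
    ∃ g : ℂ[X], g ≠ 0 ∧ F.re * K.D g + F.im * K.S g = 0 := by
  obtain ⟨M, hM⟩ : ∃ M : ℂ[X] →ₗ[ℂ] ℂ[X], ∀ g, M g = F.re * K.D g + F.im * K.S g :=
    ⟨{ toFun := fun g => F.re * K.D g + F.im * K.S g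
       map_add' := fun f g => by simp only [map_add]; ring
       map_smul' := fun c f => by
        simp only [map_smul, RingHom.id_apply, smul_add, mul_smul_comm] }, fun _ => rfl⟩
  have hmem : ∀ g : ℂ[X], g ∈ degreeLT ℂ (n + 1) ↔ g.natDegree ≤ n := fun g => by
    rw [mem_degreeLT, degree_lt_iff_coeff_zero, natDegree_le_iff_coeff_eq_zero]
    simp
  have hmap : ∀ g ∈ degreeLT ℂ (n + 1), M g ∈ degreeLT ℂ (n + 1) := by
    intro g hg
    rw [hmem] at hg ⊢
    obtain ⟨h1, h2⟩ := hd.natDegree_mul_add_coeff hg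
    rw [h, zero_mul] at h2
    rw [hM]
    have h3 := natDegree_sub_C_mul_X_pow_le h1
    rwa [h2, C_0, zero_mul, sub_zero] at h3
  have : Module.Finite ℂ (degreeLT ℂ (n + 1)) := Module.Finite.equiv (degreeLTEquiv ℂ (n + 1)).symm
  have hns : ¬ Function.Surjective (M.restrict hmap) := by
    intro hs
    obtain ⟨g, hg⟩ := hs ⟨p 0, (hmem _).2 (by rw [hp.natDegree_eq]; omega)⟩
    have h1 : M g = p 0 := congrArg Subtype.val hg
    have h2 : u (p 0) = 0 := by
      rw [← h1, hM]
      exact (pearson_iff F).1 hF g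
    refine hp.apply_mul_ne_zero 0 ?_
    have h3 : p 0 = C ((p 0).coeff 0) := eq_C_of_natDegree_eq_zero (hp.natDegree_eq 0)
    conv_lhs => enter [2, 1]; rw [h3]
    rw [LinearMap.apply_C_mul, h2, mul_zero]
  rw [← LinearMap.injective_iff_surjective, injective_iff_map_eq_zero] at hns
  push Not at hns
  obtain ⟨g, hg, hg0⟩ := hns
  refine ⟨g, fun h0 => hg0 (Subtype.ext h0), ?_⟩
  rw [← hM]
  exact congrArg Subtype.val hg

/-- The regularity condition of the Pearson equation. -/
theorem Pearson.lead_ne_zero (hK : K.Nondegenerate) (hp : IsOPS u p) {F : K.Pair}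
    (hF : Pearson u F) (hd : DegreeLE F 1) (h0 : F ≠ 0) (n : ℕ) :
    F.re.coeff 2 * K.γ n + F.im.coeff 1 * K.σ n ≠ 0 := by
  intro h
  obtain ⟨g, hg, hz⟩ := exists_mul_D_add_mul_S_eq_zero hp hF hd h
  have him : (F * K.ev g).im = 0 := by
    rw [QuadraticAlgebra.im_mul, ev_re, ev_im, zero_mul, zero_mul, add_zero, hz]
  -- F g(y) is again a solution; as its ω-component is zero, its other component is orthogonal to
  -- the range of `D`.
  have hre : (F * K.ev g).re = 0 := hp.regular _ fun r => by
    obtain ⟨q, rfl⟩ := hK.D_surjective r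
    have h1 := hF (g * q)
    rw [map_mul, ← mul_assoc, QuadraticAlgebra.im_mul _ (K.ev q), him, ev_im] at h1
    simpa using h1
  refine h0 (eq_zero_of_ev_mul hg ?_)
  rw [mul_comm]
  ext1
  · exact hre
  · exact him

/-- The norm of the pair `(φ, ψ)`. -/
noncomputable def normPoly (F : K.Pair) : ℂ[X] := F.re ^ 2 - K.U * F.im ^ 2

theorem DegreeLE.natDegree_normPoly {F : K.Pair} (hd : DegreeLE F 1) :
    (normPoly F).natDegree ≤ 4 := by
  have h1 := natDegree_pow_le_of_le 2 hd.1
  have h2 := natDegree_pow_le_of_le 2 hd.2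
  have h3 := K.natDegree_U
  exact (natDegree_sub_le _ _).trans (max_le h1 (natDegree_mul_le.trans (by omega)))

/-- The adjoint of the second divided difference with respect to the functional multiplied by the
norm of a solution of the Pearson equation. -/
theorem Pearson.exists_adjoint (hK : K.Nondegenerate) {F : K.Pair} (hF : Pearson u F)
    (hd : DegreeLE F 1) {g : ℂ[X]} {n : ℕ} (hg : g.natDegree ≤ n) :
    ∃ r : ℂ[X], (∀ f, u (K.D (K.D f) * g * normPoly F) = u (f * r)) ∧ r.natDegree ≤ n + 2 ∧
      r.coeff (n + 2) = (F.re.coeff 2 * K.γ (n + 1) + F.im.coeff 1 * K.σ (n + 1)) *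
        (F.re.coeff 2 * K.γ (n + 2) + F.im.coeff 1 * K.σ (n + 2)) * g.coeff n := by
  obtain ⟨f1, f2⟩ := id hd
  -- G is g times the conjugate of F, so F G = g · `normPoly F`.
  obtain ⟨G, hG⟩ : ∃ G : K.Pair, G = ⟨F.re * g, -F.im * g⟩ := ⟨_, rfl⟩
  have hb : (K.coordX G).natDegree ≤ n + 1 ∧ (K.coordX G).coeff (n + 1) =
      (F.re.coeff 2 * K.γ (n + 2) + F.im.coeff 1 * K.σ (n + 2)) * g.coeff n := by
    have e : K.coordX G = K.D (F.re * g + K.A * (F.im * g)) - X * K.D (F.im * g) := by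
      rw [hG, coordX]
      simp only [neg_mul, map_neg, mul_neg, sub_neg_eq_add]
      ring
    have d1 : (F.re * g).natDegree ≤ n + 2 := natDegree_mul_le.trans (by omega)
    have c1 : (F.re * g).coeff (n + 2) = F.re.coeff 2 * g.coeff n := by
      rw [add_comm n 2]; exact coeff_mul_add_eq_of_natDegree_le f1 hg
    have d2 : (F.im * g).natDegree ≤ n + 1 := natDegree_mul_le.trans (by omega)
    have c2 : (F.im * g).coeff (n + 1) = F.im.coeff 1 * g.coeff n := by
      rw [add_comm n 1]; exact coeff_mul_add_eq_of_natDegree_le f2 hg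
    have hA := K.natDegree_A
    have d3 : (K.A * (F.im * g)).natDegree ≤ n + 2 := natDegree_mul_le.trans (by omega)
    have c3 : (K.A * (F.im * g)).coeff (n + 2) = K.α * (F.im.coeff 1 * g.coeff n) := by
      rw [← c2, ← coeff_A, show n + 2 = 1 + (n + 1) by ring]
      exact coeff_mul_add_eq_of_natDegree_le hA d2
    obtain ⟨d4, c4⟩ := K.natDegree_D_coeff (natDegree_add_le_of_degree_le d1 d3)
    obtain ⟨d5, c5⟩ := K.natDegree_D_coeff d2
    rw [e]
    refine ⟨(natDegree_sub_le _ _).trans (max_le d4 (natDegree_mul_le.trans ?_)), ?_⟩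
    · rw [natDegree_X]; omega
    · rw [coeff_sub, c4, coeff_X_mul, c5, coeff_add, c1, c2, c3, K.γ_succ (n + 1),
        K.σ_succ (n + 1)]
      ring
  -- Split G = a(y) + x b(y). The first part contributes a Pearson term. With D h = b, the second
  -- matches `bochner_mul_eq` for f and h, and symmetry moves the operator onto h.
  obtain ⟨h, e1, e2, e3⟩ := hK.exists_D_eq (n + 1) _ hb.1
  obtain ⟨r1, r2⟩ := hd.natDegree_bochner_coeff e2
  refine ⟨bochner F h, fun f => ?_, r1, ?_⟩
  · rw [← hF.apply_bochner, bochner_mul_eq, map_add, hF, zero_add, e1]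
    have h1 : K.D (K.D f) * g * normPoly F = (F * G * K.ev (K.D f)).im := by
      rw [hG, QuadraticAlgebra.im_mul, QuadraticAlgebra.re_mul, QuadraticAlgebra.im_mul, ev_re,
        ev_im, normPoly]
      ring
    have h2 : F * G * K.ev (K.D f) = F * K.ev (K.D f * K.coordOne G) +
        F * K.ev (K.D f) * K.ev (K.coordX G) * K.ι X := by
      conv_lhs => rw [K.eq_coord G]
      rw [map_mul]
      ring
    rw [h1, h2, QuadraticAlgebra.im_add, map_add, hF, zero_add]
  · rw [r2, e3, hb.2]
    ring

/-- The second divided differences are orthogonal with respect to the functional multiplied by the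
norm of a solution of the Pearson equation. -/
theorem Pearson.orthogonal_D_D (hK : K.Nondegenerate) (hp : IsOPS u p) {F : K.Pair}
    (hF : Pearson u F) (hd : DegreeLE F 1) (h0 : F ≠ 0) :
    (∀ m n, 2 ≤ m → 2 ≤ n → m ≠ n →
      u (K.D (K.D (p m)) * K.D (K.D (p n)) * normPoly F) = 0) ∧
    ∀ n, 2 ≤ n → u (K.D (K.D (p n)) * K.D (K.D (p n)) * normPoly F) ≠ 0 := by
  have key : ∀ m n, 2 ≤ m → m < n →
      u (K.D (K.D (p n)) * K.D (K.D (p m)) * normPoly F) = 0 := by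
    intro m n hm hmn
    obtain ⟨m, rfl⟩ : ∃ k, m = k + 2 := ⟨m - 2, by omega⟩
    obtain ⟨r, hr, hrd, -⟩ := hF.exists_adjoint hK hd (hp.D_D_natDegree_coeff hK m).1
    rw [hr, mul_comm]
    exact hp.apply_mul_of_natDegree_lt (by omega)
  constructor
  · intro m n hm hn hmn
    rcases hmn.lt_or_gt with h | h
    · rw [mul_comm (K.D (K.D (p m)))]
      exact key m n hm h
    · exact key n m hn h
  · intro n hn
    obtain ⟨n, rfl⟩ : ∃ k, n = k + 2 := ⟨n - 2, by omega⟩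
    obtain ⟨h1, h2⟩ := hp.D_D_natDegree_coeff hK n
    obtain ⟨r, hr, hrd, hrc⟩ := hF.exists_adjoint hK hd h1
    rw [hr, mul_comm]
    refine hp.apply_mul_ne_zero_of_coeff hrd ?_
    rw [hrc]
    exact mul_ne_zero (mul_ne_zero (hF.lead_ne_zero hK hp hd h0 _)
      (hF.lead_ne_zero hK hp hd h0 _)) h2

end LatticeData

/-! ### The operators of a lattice come from nondegenerate lattice data. -/

namespace LatticeData

variable {K : LatticeData}

/-- The hypotheses are symmetric in a and b, so it serves for both neighbours. -/
theorem eval_eq_S_add_D {t a b : ℂ} (hA : K.A.eval t = (a + b) / 2)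
    (hU : K.U.eval t = ((a - b) / 2) ^ 2) (f : ℂ[X]) :
    f.eval a = (K.S f).eval t + (K.D f).eval t * ((a - b) / 2) := by
  induction f using Polynomial.induction_on' with
  | add f g hf hg => simp only [map_add, eval_add, hf, hg]; ring
  | monomial n c =>
    rw [← C_mul_X_pow_eq_monomial]
    induction n with
    | zero => simp [S_C, D_C]
    | succ n ih =>
      have h : C c * X ^ (n + 1) = X * (C c * X ^ n) := by ring
      rw [h, S_X_mul, D_X_mul, eval_mul, eval_X, ih]
      simp only [eval_add, eval_mul, hA, hU]
      ring

end LatticeData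

namespace QLattice

theorem D_S_eq_of_eval {L : QLattice} {K : LatticeData}
    (hA : ∀ s, K.A.eval (L.x s) = (L.x (s + 1 / 2) + L.x (s - 1 / 2)) / 2)
    (hU : ∀ s, K.U.eval (L.x s) = ((L.x (s + 1 / 2) - L.x (s - 1 / 2)) / 2) ^ 2) (f : ℂ[X]) :
    L.D f = K.D f ∧ L.S f = K.S f := by
  have key : ∀ s, f.eval (L.x (s + 1 / 2)) = (K.S f).eval (L.x s) +
        (K.D f).eval (L.x s) * ((L.x (s + 1 / 2) - L.x (s - 1 / 2)) / 2) ∧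
      f.eval (L.x (s - 1 / 2)) = (K.S f).eval (L.x s) +
        (K.D f).eval (L.x s) * ((L.x (s - 1 / 2) - L.x (s + 1 / 2)) / 2) := fun s =>
    ⟨LatticeData.eval_eq_S_add_D (hA s) (hU s) f, LatticeData.eval_eq_S_add_D
      (by rw [hA, add_comm]) (by rw [hU]; ring) f⟩
  constructor
  · refine (L.existsUnique_divDiff f).unique (L.D_spec f) fun s => ?_
    rw [(key s).1, (key s).2]; ring
  · refine (L.existsUnique_mean f).unique (L.S_spec f) fun s => ?_
    rw [(key s).1, (key s).2]; ring

/-- The operators of a lattice are those of suitable nondegenerate lattice data. -/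
theorem exists_latticeData (L : QLattice) :
    ∃ K : LatticeData, K.Nondegenerate ∧ ∀ f, L.D f = K.D f ∧ L.S f = K.S f := by
  cases L with
  | qQuadratic q c₁ c₂ c₃ hq hr hc =>
    obtain ⟨w, hw⟩ : ∃ w, w = q ^ (1 / 2 : ℂ) := ⟨_, rfl⟩
    have hw' : q ^ (-(1 / 2) : ℂ) = w⁻¹ := by rw [Complex.cpow_neg, hw]
    have hw2 : w ^ 2 = q := by
      rw [hw, pow_two, ← Complex.cpow_add _ _ hq]; norm_num
    have hw0 : w ≠ 0 := by
      rintro rfl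
      exact hq (by rw [← hw2]; ring)
    have hww : w * w⁻¹ = 1 := mul_inv_cancel₀ hw0
    obtain ⟨K, hα, hβ, hυ⟩ : ∃ K : LatticeData, K.α = (w + w⁻¹) / 2 ∧
        K.β = c₃ * (1 - (w + w⁻¹) / 2) ∧
        K.υ = ((w - w⁻¹) / 2) ^ 2 * (c₃ ^ 2 - 4 * c₁ * c₂) := ⟨⟨_, _, _⟩, rfl, rfl, rfl⟩
    refine ⟨K, fun n hn => ?_, D_S_eq_of_eval (fun s => ?_) fun s => ?_⟩
    -- With w² = q, a zero of γ at m = n + 1 gives w^m = w^(-m), hence q^m = 1.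
    · have key : ∀ m, K.γ m * (w - w⁻¹) = w ^ m - w⁻¹ ^ m ∧
          2 * K.σ m = w ^ m + w⁻¹ ^ m := by
        intro m
        induction m with
        | zero => rw [K.γ_zero, K.σ_zero]; norm_num
        | succ m ih =>
          obtain ⟨h1, h2⟩ := ih
          rw [K.γ_succ, K.σ_succ, hα, pow_succ, pow_succ]
          constructor
          · linear_combination ((w + w⁻¹) / 2) * h1 + ((w - w⁻¹) / 2) * h2
          · linear_combination ((w + w⁻¹) / 2) * h2 + ((w - w⁻¹) / 2) * h1 +
              2 * K.γ m * hww
      have h := (key (n + 1)).1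
      rw [hn, zero_mul] at h
      refine hr (n + 1) (by omega) ?_
      have h1 : w ^ (n + 1) * w⁻¹ ^ (n + 1) = 1 := by rw [← mul_pow, hww, one_pow]
      rw [← hw2, ← pow_mul, mul_comm, pow_mul, pow_two]
      linear_combination (-w ^ (n + 1)) * h + h1
    · have e1 : -(s + 1 / 2) = -s + -(1 / 2) := by ring
      have e2 : -(s - 1 / 2) = -s + 1 / 2 := by ring
      have e3 : s - 1 / 2 = s + -(1 / 2) := by ring
      simp only [LatticeData.A, x, eval_add, eval_mul, eval_C, eval_X, hα, hβ]
      rw [e1, e2, e3]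
      simp only [Complex.cpow_add _ _ hq, hw', ← hw]
      ring
    · have e1 : -(s + 1 / 2) = -s + -(1 / 2) := by ring
      have e2 : -(s - 1 / 2) = -s + 1 / 2 := by ring
      have e3 : s - 1 / 2 = s + -(1 / 2) := by ring
      have h : q ^ (-s) * q ^ s = 1 := by
        rw [← Complex.cpow_add _ _ hq]; simp
      simp only [LatticeData.U, x, eval_add, eval_mul, eval_C, eval_X, eval_pow, hα, hβ, hυ]
      rw [e1, e2, e3]
      simp only [Complex.cpow_add _ _ hq, hw', ← hw]
      generalize q ^ (-s) = a at h ⊢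
      generalize q ^ s = b at h ⊢
      linear_combination 4 * c₁ * c₂ * ((w - w⁻¹) / 2) ^ 2 * h +
        ((c₁ * a + c₂ * b + c₃) ^ 2 - 2 * c₃ * (c₁ * a + c₂ * b + c₃)) * hww
  | quadratic c₄ c₅ c₆ hc =>
    obtain ⟨K, hα, hβ, hυ⟩ : ∃ K : LatticeData, K.α = 1 ∧ K.β = c₄ / 4 ∧
        K.υ = c₅ ^ 2 / 4 - c₄ * c₆ := ⟨⟨_, _, _⟩, rfl, rfl, rfl⟩
    refine ⟨K, fun n hn => ?_, D_S_eq_of_eval (fun s => ?_) fun s => ?_⟩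
    · have key : ∀ m, K.γ m = m ∧ K.σ m = 1 := by
        intro m
        induction m with
        | zero => rw [K.γ_zero, K.σ_zero]; norm_num
        | succ m ih =>
          rw [K.γ_succ, K.σ_succ, hα, ih.1, ih.2]
          push_cast
          constructor <;> ring
      rw [(key _).1] at hn
      exact n.succ_ne_zero (Nat.cast_eq_zero.1 hn)
    · simp only [LatticeData.A, x, eval_add, eval_mul, eval_C, eval_X, hα, hβ]
      ring
    · simp only [LatticeData.U, x, eval_add, eval_mul, eval_C, eval_X, eval_pow, hα, hβ, hυ]
      ring

end QLattice

/-! ### Structure relation and orthogonality. -/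

namespace LatticeData

variable {K : LatticeData} {u : ℂ[X] →ₗ[ℂ] ℂ} {p : ℕ → ℂ[X]}

/-- The expansion of π D²p_n starts at p_{n-2}, while D²p_m has degree m - 2. Hence the pairing
vanishes for m < n, and for m = n only the term with the nonzero coefficient survives. -/
theorem orthogonal_D_D_of_structure_relation (hK : K.Nondegenerate) (hp : IsOPS u p) {π : ℂ[X]}
    {a : ℕ → ℕ → ℂ} (ha : ∀ n, 2 ≤ n → a n (n - 2) ≠ 0 ∧
      π * K.D (K.D (p n)) = ∑ m ∈ Finset.Icc (n - 2) (n + 2), C (a n m) * p m) :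
    (∀ m n, 2 ≤ m → 2 ≤ n → m ≠ n → u (K.D (K.D (p m)) * K.D (K.D (p n)) * π) = 0) ∧
      ∀ n, 2 ≤ n → u (K.D (K.D (p n)) * K.D (K.D (p n)) * π) ≠ 0 := by
  have hsum : ∀ n, 2 ≤ n → ∀ f, u (f * K.D (K.D (p n)) * π) =
      ∑ m ∈ Finset.Icc (n - 2) (n + 2), a n m * u (f * p m) := by
    intro n hn f
    have e : f * K.D (K.D (p n)) * π = ∑ m ∈ Finset.Icc (n - 2) (n + 2), C (a n m) * (f * p m) := by
      rw [show f * K.D (K.D (p n)) * π = f * (π * K.D (K.D (p n))) by ring, (ha n hn).2,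
        Finset.mul_sum]
      exact Finset.sum_congr rfl fun m _ => by ring
    rw [e, map_sum]
    exact Finset.sum_congr rfl fun m _ => LinearMap.apply_C_mul u _ _
  have hlt : ∀ m n, 2 ≤ m → m < n → u (K.D (K.D (p m)) * K.D (K.D (p n)) * π) = 0 := by
    intro m n hm hmn
    obtain ⟨m, rfl⟩ := Nat.exists_eq_add_of_le' hm
    rw [hsum n (by omega)]
    refine Finset.sum_eq_zero fun j hj => ?_
    rw [hp.apply_mul_of_natDegree_lt, mul_zero]
    have := (hp.D_D_natDegree_coeff hK m).1
    have := (Finset.mem_Icc.1 hj).1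
    omega
  refine ⟨fun m n hm hn hmn => ?_, fun n hn => ?_⟩
  · rcases lt_or_gt_of_ne hmn with h | h
    · exact hlt m n hm h
    · rw [mul_comm (K.D (K.D (p m)))]
      exact hlt n m hn h
  · have h := (ha n hn).1
    obtain ⟨n, rfl⟩ := Nat.exists_eq_add_of_le' hn
    obtain ⟨d1, d2⟩ := hp.D_D_natDegree_coeff hK n
    rw [hsum _ hn, Finset.sum_eq_single_of_mem n (Finset.mem_Icc.2 ⟨by omega, by omega⟩)]
    · exact mul_ne_zero h (hp.apply_mul_ne_zero_of_coeff d1 d2)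
    · intro j hj hjn
      rw [hp.apply_mul_of_natDegree_lt, mul_zero]
      have := (Finset.mem_Icc.1 hj).1
      omega

theorem structure_relation_of_orthogonal_D_D (hK : K.Nondegenerate) (hp : IsOPS u p) {π : ℂ[X]}
    (hπ : π.natDegree ≤ 4)
    (ho : ∀ m n, 2 ≤ m → 2 ≤ n → m ≠ n → u (K.D (K.D (p m)) * K.D (K.D (p n)) * π) = 0)
    (hn : ∀ n, 2 ≤ n → u (K.D (K.D (p n)) * K.D (K.D (p n)) * π) ≠ 0) :
    ∃ a : ℕ → ℕ → ℂ, ∀ n, 2 ≤ n → a n (n - 2) ≠ 0 ∧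
      π * K.D (K.D (p n)) = ∑ m ∈ Finset.Icc (n - 2) (n + 2), C (a n m) * p m := by
  -- The D²p_{n+2} form an orthogonal sequence for πu, so π D²p_{n+2} is orthogonal under u to all
  -- degrees below n; deg π ≤ 4 bounds the expansion from above.
  have hQ : IsOPS (u ∘ₗ LinearMap.mulRight ℂ π) (fun n => K.D (K.D (p (n + 2)))) :=
    { natDegree_eq := fun n => natDegree_eq_of_le_of_coeff_ne_zero
        (hp.D_D_natDegree_coeff hK n).1 (hp.D_D_natDegree_coeff hK n).2
      apply_mul_eq_zero := fun m n hmn => ho _ _ (by omega) (by omega) (by omega)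
      apply_mul_ne_zero := fun n => hn _ (by omega) }
  refine ⟨fun n m => u (π * K.D (K.D (p n)) * p m) / u (p m * p m), fun n h2 => ?_⟩
  obtain ⟨n, rfl⟩ := Nat.exists_eq_add_of_le' h2
  have hv : ∀ f, u (π * K.D (K.D (p (n + 2))) * f) =
      (u ∘ₗ LinearMap.mulRight ℂ π) (f * K.D (K.D (p (n + 2)))) := fun f =>
    congrArg u (by rw [LinearMap.mulRight_apply]; ring)
  constructor
  · refine div_ne_zero ?_ (hp.apply_mul_ne_zero _)
    rw [hv]
    exact hQ.apply_mul_ne_zero_of_coeff (hp.natDegree_eq n).le (hp.coeff_ne_zero n)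
  · refine sub_eq_zero.1 (hp.eq_zero_of_natDegree_le (n := n + 2 + 2) ?_ fun j hj => ?_)
    · have h1 := (hp.D_D_natDegree_coeff hK n).1
      refine (natDegree_sub_le _ _).trans (max_le (natDegree_mul_le.trans (by omega)) ?_)
      refine natDegree_sum_le_of_forall_le _ _ fun m hm => (natDegree_C_mul_le _ _).trans ?_
      rw [hp.natDegree_eq]
      exact (Finset.mem_Icc.1 hm).2
    · have e : ∀ m, u (C (u (π * K.D (K.D (p (n + 2))) * p m) / u (p m * p m)) * p m * p j) =
          if m = j then u (π * K.D (K.D (p (n + 2))) * p m) else 0 := by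
        intro m
        rw [mul_assoc, LinearMap.apply_C_mul]
        split_ifs with h
        · rw [← h, div_mul_cancel₀ _ (hp.apply_mul_ne_zero m)]
        · rw [hp.apply_mul_eq_zero m j h, mul_zero]
      rw [sub_mul, map_sub, Finset.sum_mul, map_sum, Finset.sum_congr rfl fun m _ => e m,
        Finset.sum_ite_eq', sub_eq_zero]
      split_ifs with h
      · rfl
      · rw [hv]
        rw [Finset.mem_Icc] at h
        exact hQ.apply_mul_of_natDegree_lt (by rw [hp.natDegree_eq]; omega)

end LatticeData

/-! ### The moment functional of the measure. -/

namespace IsOrthogonalSeq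

variable {μ : Measure ℝ} {P : ℕ → ℝ[X]}

theorem integrable_eval (hP : IsOrthogonalSeq μ P) (f : ℂ[X]) :
    Integrable (fun t : ℝ => f.eval (t : ℂ)) μ := by
  simp only [eval_eq_sum_range]
  refine integrable_finsetSum _ fun i _ => Integrable.const_mul ?_ _
  simpa using (hP.integrable_pow i).ofReal (𝕜 := ℂ)

/-- Integration of complex polynomials over the real line. -/
noncomputable def functional (hP : IsOrthogonalSeq μ P) : ℂ[X] →ₗ[ℂ] ℂ where
  toFun f := ∫ t : ℝ, f.eval (t : ℂ) ∂μ
  map_add' f g := by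
    simp only [eval_add]
    exact integral_add (hP.integrable_eval f) (hP.integrable_eval g)
  map_smul' c f := by
    simp only [eval_smul, RingHom.id_apply]
    exact integral_smul c _

theorem functional_apply (hP : IsOrthogonalSeq μ P) (f : ℂ[X]) :
    hP.functional f = ∫ t : ℝ, f.eval (t : ℂ) ∂μ := rfl

theorem functional_mul_toComplexPoly (hP : IsOrthogonalSeq μ P) (f g : ℝ[X]) :
    hP.functional (toComplexPoly f * toComplexPoly g) =
      ((∫ t, f.eval t * g.eval t ∂μ : ℝ) : ℂ) := by
  have h : ∀ (f : ℝ[X]) (t : ℝ), (toComplexPoly f).eval (t : ℂ) = ((f.eval t : ℝ) : ℂ) :=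
    fun f t => (eval_map _ _).trans (eval₂_at_apply _ t)
  rw [functional_apply, ← integral_complex_ofReal]
  simp only [eval_mul, h, Complex.ofReal_mul]

theorem isOPS (hP : IsOrthogonalSeq μ P) : IsOPS hP.functional (fun n => toComplexPoly (P n)) where
  natDegree_eq n := (natDegree_map _).trans (hP.natDegree_eq n)
  apply_mul_eq_zero m n hmn := by
    rw [functional_mul_toComplexPoly, hP.integral_eq_zero m n hmn, Complex.ofReal_zero]
  apply_mul_ne_zero n := by
    rw [functional_mul_toComplexPoly]
    exact Complex.ofReal_ne_zero.2 (hP.integral_pos n).ne'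

theorem isOrthogonalFromTwo_iff (hP : IsOrthogonalSeq μ P) (π : ℂ[X]) (Q : ℕ → ℂ[X]) :
    IsOrthogonalFromTwo μ π Q ↔
      (∀ m n, 2 ≤ m → 2 ≤ n → m ≠ n → hP.functional (Q m * Q n * π) = 0) ∧
        ∀ n, 2 ≤ n → hP.functional (Q n * Q n * π) ≠ 0 := by
  simp only [IsOrthogonalFromTwo, functional_apply, eval_mul]

end IsOrthogonalSeq

theorem theorem4p2 (L : QLattice) (μ : Measure ℝ) (P : ℕ → ℝ[X]) (hP : IsOrthogonalSeq μ P) :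
    List.TFAE [
      -- (a) the first structure relation
      ∃ (π : ℂ[X]) (a : ℕ → ℕ → ℂ), π.natDegree ≤ 4 ∧ ∀ n : ℕ, 2 ≤ n →
        a n (n - 2) ≠ 0 ∧
        π * L.D (L.D (toComplexPoly (P n))) =
          ∑ m ∈ Finset.Icc (n - 2) (n + 2), C (a n m) * toComplexPoly (P m),
      -- (b) orthogonality of the second divided differences
      ∃ π : ℂ[X], π.natDegree ≤ 4 ∧
        IsOrthogonalFromTwo μ π (fun n => L.D (L.D (toComplexPoly (P n)))),
      -- (c) the Sturm-Liouville type equation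
      ∃ (φ ψ : ℂ[X]) (lam : ℕ → ℂ), φ.natDegree ≤ 2 ∧ ψ.natDegree = 1 ∧ ∀ n : ℕ, 5 ≤ n →
        φ * L.D (L.D (toComplexPoly (P n))) + ψ * L.S (L.D (toComplexPoly (P n))) +
          C (lam n) * toComplexPoly (P n) = 0] := by
  obtain ⟨K, hK, hL⟩ := L.exists_latticeData
  have hp := hP.isOPS
  simp only [hP.isOrthogonalFromTwo_iff, (hL _).1, (hL _).2]
  tfae_have 1 → 2
  | ⟨π, a, hπ, ha⟩ => ⟨π, hπ, LatticeData.orthogonal_D_D_of_structure_relation hK hp ha⟩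
  tfae_have 2 → 1
  | ⟨π, hπ, ho, hn⟩ =>
    let ⟨a, ha⟩ := LatticeData.structure_relation_of_orthogonal_D_D hK hp hπ ho hn
    ⟨π, a, hπ, ha⟩
  tfae_have 2 → 3
  | ⟨π, hπ, ho, hn⟩ => by
    obtain ⟨F, h0, hd, hF⟩ := LatticeData.exists_pearson_degreeLE_one hK hp hπ ho hn
    choose c hc using hp.exists_bochner_eq hF hd
    refine ⟨F.re, F.im, fun n => -c n, hd.1, hF.natDegree_im hK hp hd h0, fun n _ => ?_⟩
    rw [← LatticeData.bochner_apply, hc, C_neg]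
    ring
  tfae_have 3 → 2
  | ⟨φ, ψ, lam, hφ, hψ, h⟩ => by
    obtain ⟨F, rfl, rfl⟩ : ∃ F : K.Pair, F.re = φ ∧ F.im = ψ := ⟨⟨φ, ψ⟩, rfl, rfl⟩
    have hd : LatticeData.DegreeLE F 1 := ⟨hφ, hψ.le⟩
    have h0 : F ≠ 0 := by
      rintro rfl
      simp at hψ
    have hF := LatticeData.pearson_of_bochner_eq hK hp hd 5 fun n hn => ⟨-lam n, by
      rw [LatticeData.bochner_apply, C_neg]
      linear_combination h n hn⟩
    exact ⟨LatticeData.normPoly F, hd.natDegree_normPoly, hF.orthogonal_D_D hK hp hd h0⟩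
  tfae_finish
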